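/- Let $T>0$, $\Theta=(\alpha,\beta)$ a bounded open interval, and for $\vartheta\in\Theta$, $\varepsilon>0$ let $(X_t,Y_t)_{0\le t\le T}$ solve $$dX_t=f(t)Y_t\,dt+\varepsilon\sigma(t)\,dW_t,\quad X_0=0,\qquad dY_t=a(\vartheta,t)Y_t\,dt+\varepsilon b(t)\,dV_t,\quad Y_0=y_0,$$ where $W,V$ are independent Wiener processes; $\mathbf P_{\vartheta}$, $\mathbf E_{\vartheta}$ denote probability and expectation when $\vartheta$ is the true parameter. Assume: (R1) $f,\sigma,b$ are bounded on $[0,T]$ and $a$ is bounded on $\Theta\times[0,T]$ (all measurable in $t$); moreover $f$ is continuous at $0$ and $f(0)\neq0$; (R2') $a(\vartheta,t)$ is continuously differentiable in $\vartheta$ on $\Theta$, its derivative $\dot a(\vartheta,t)=\partial_\vartheta a(\vartheta,t)$ is continuously differentiable in $t\in[0,T]$, and $\dot a(\vartheta,t)\to\dot a(\vartheta,0)$ as $t\to0$ uniformly in $\vartheta\in\Theta$; (R3') $\inf_{\vartheta\in\Theta}a(\vartheta,0)>0$ and $\inf_{\vartheta\in\Theta}\dot a(\vartheta,0)>0$;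 (R4) $y_0\neq0$. Put $$x_t(\vartheta)=y_0\int_0^t f(s)\exp\Big\{\int_0^s a(\vartheta,r)\,dr\Big\}ds,\quad x_m(t)=\inf_{\vartheta\in\Theta}x_t(\vartheta),\quad x_M(t)=\sup_{\vartheta\in\Theta}x_t(\vartheta),$$ let $\tau_\varepsilon=\varepsilon^\delta$ with $\delta\in(0,2/3)$, and define the preliminary estimator $\bar\vartheta_{\tau_\varepsilon}$ to be $\alpha$ if $X_{\tau_\varepsilon}\le x_m(\tau_\varepsilon)$, $\beta$ if $X_{\tau_\varepsilon}\ge x_M(\tau_\varepsilon)$, and otherwise the solution $\mu_\varepsilon\in\Theta$ of $x_{\tau_\varepsilon}(\mu_\varepsilon)=X_{\tau_\varepsilon}$ (which is unique for all sufficiently small $\varepsilon$). Then for every compact $\mathbb K\subset\Theta$ the estimator is uniformly consistent on $\mathbb K$: for every $\nu>0$, $$\sup_{\vartheta_0\in\mathbb K}\mathbf P_{\vartheta_0}\big(|\bar\vartheta_{\tau_\varepsilon}-\vartheta_0|>\nu\big)\longrightarrow0\qquad(\varepsilon\to0);$$ and there are constants $C>0$, $\varepsilon_0>0$, depending on $\mathbb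 K$, $\delta$ and the model but not on $\vartheta_0$ or $\varepsilon$, such that $$\sup_{\vartheta_0\in\mathbb K}\mathbf E_{\vartheta_0}|\bar\vartheta_{\tau_\varepsilon}-\vartheta_0|^2\le C\,\varepsilon^{2-3\delta}\qquad\text{for }0<\varepsilon<\varepsilon_0.$$ -/

import Mathlib

open MeasureTheory ProbabilityTheory Filter Topology
open scoped NNReal ENNReal

/-- A step function on `[0, ∞)`: a finite linear combination of indicators of intervals
`(left i, right i]`. -/
structure WienerStep where
  n : ℕ
  left : Fin n → ℝ≥0
  right : Fin n → ℝ≥0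
  coeff : Fin n → ℝ
  le : ∀ i, left i ≤ right i

/-- The step function itself. -/
noncomputable def WienerStep.eval (φ : WienerStep) (s : ℝ) : ℝ :=
  ∑ i, φ.coeff i * (Set.Ioc (φ.left i : ℝ) (φ.right i : ℝ)).indicator (fun _ => (1 : ℝ)) s

/-- The integral of a step function against the increments of a process `B`. -/
noncomputable def WienerStep.integral {Ω : Type*} (φ : WienerStep) (B : ℝ≥0 → Ω → ℝ) (ω : Ω) : ℝ :=
  ∑ i, φ.coeff i * (B (φ.right i) ω - B (φ.left i) ω)

/-- `I` is (a version of) the stochastic integral `∫₀ᵗ g(s) dB_s` of the deterministic function `g`: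
the `L²(P)`-limit of the integrals of step functions on `[0, t]` that converge to `g` in
`L²([0, t])`. -/
def IsWienerIntegral {Ω : Type*} [MeasurableSpace Ω] (P : Measure Ω) (B : ℝ≥0 → Ω → ℝ)
    (g : ℝ → ℝ) (t : ℝ) (I : Ω → ℝ) : Prop :=
  AEStronglyMeasurable I P ∧
  ∃ φ : ℕ → WienerStep,
    (∀ n i, ((φ n).right i : ℝ) ≤ t) ∧
    Tendsto (fun n => eLpNorm (fun s => (φ n).eval s - g s) 2 (volume.restrict (Set.Icc 0 t)))
      atTop (𝓝 0) ∧
    Tendsto (fun n => eLpNorm (fun ω => (φ n).integral B ω - I ω) 2 P) atTop (𝓝 0)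

/-- The data of the partially observed linear system
`dX_t = f(t) Y_t dt + ε σ(t) dW_t`, `X_0 = 0`,
`dY_t = a(ϑ, t) Y_t dt + ε b(t) dV_t`, `Y_0 = y₀`, for `t ∈ [0, T]` and `ϑ ∈ Θ = (α, β)`. -/
structure HiddenModel where
  T : ℝ
  α : ℝ
  β : ℝ
  y₀ : ℝ
  f : ℝ → ℝ
  σ : ℝ → ℝ
  b : ℝ → ℝ
  a : ℝ → ℝ → ℝ

namespace HiddenModel

/-- The parameter set `Θ = (α, β)`. -/
def Θ (M : HiddenModel) : Set ℝ := Set.Ioo M.α M.β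

/-- The derivative of `a(ϑ, t)` with respect to `ϑ`. -/
noncomputable def aDot (M : HiddenModel) (ϑ t : ℝ) : ℝ := deriv (fun θ => M.a θ t) ϑ

/-- The coefficients are (measurable and) bounded on `[0, T]`, `a` uniformly in `ϑ ∈ Θ`. -/
structure BoundedCoefficients (M : HiddenModel) : Prop where
  aemeasurable_f : AEMeasurable M.f (volume.restrict (Set.Icc 0 M.T))
  aemeasurable_σ : AEMeasurable M.σ (volume.restrict (Set.Icc 0 M.T))
  aemeasurable_b : AEMeasurable M.b (volume.restrict (Set.Icc 0 M.T))
  aemeasurable_a : ∀ ϑ ∈ M.Θ, AEMeasurable (M.a ϑ) (volume.restrict (Set.Icc 0 M.T))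
  bounded : ∃ L : ℝ, ∀ t ∈ Set.Icc 0 M.T,
    |M.f t| ≤ L ∧ |M.σ t| ≤ L ∧ |M.b t| ≤ L ∧ ∀ ϑ ∈ M.Θ, |M.a ϑ t| ≤ L

/-- `a` is continuously differentiable in `ϑ`, and its `ϑ`-derivative is continuously
differentiable in `t`, its continuity at `t = 0` being uniform in `ϑ ∈ Θ`. -/
structure SmoothDrift (M : HiddenModel) : Prop where
  contDiff_ϑ : ∀ t ∈ Set.Icc 0 M.T, ContDiffOn ℝ 1 (fun ϑ => M.a ϑ t) M.Θ
  contDiff_t : ∀ ϑ ∈ M.Θ, ContDiffOn ℝ 1 (fun t => M.aDot ϑ t) (Set.Icc 0 M.T)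
  uniform_zero : TendstoUniformlyOn (fun t ϑ => M.aDot ϑ t) (fun ϑ => M.aDot ϑ 0) (𝓝[>] 0) M.Θ

/-- `inf_{ϑ ∈ Θ} a(ϑ, 0) > 0` and `inf_{ϑ ∈ Θ} ȧ(ϑ, 0) > 0`. -/
def SeparatedFromZero (M : HiddenModel) : Prop :=
  (∃ c > 0, ∀ ϑ ∈ M.Θ, c ≤ M.a ϑ 0) ∧ (∃ c > 0, ∀ ϑ ∈ M.Θ, c ≤ M.aDot ϑ 0)

/-- The solution `y_t(ϑ)` of the state equation without noise. -/
noncomputable def limY (M : HiddenModel) (ϑ t : ℝ) : ℝ :=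
  M.y₀ * Real.exp (∫ r in (0 : ℝ)..t, M.a ϑ r)

/-- The solution `x_t(ϑ)` of the observation equation without noise. -/
noncomputable def limX (M : HiddenModel) (ϑ t : ℝ) : ℝ :=
  ∫ s in (0 : ℝ)..t, M.f s * M.limY ϑ s

/-- `x_m(t) = inf_{ϑ ∈ Θ} x_t(ϑ)`. -/
noncomputable def xInf (M : HiddenModel) (t : ℝ) : ℝ := sInf ((fun ϑ => M.limX ϑ t) '' M.Θ)

/-- `x_M(t) = sup_{ϑ ∈ Θ} x_t(ϑ)`. -/
noncomputable def xSup (M : HiddenModel) (t : ℝ) : ℝ := sSup ((fun ϑ => M.limX ϑ t) '' M.Θ)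

open Classical in
/-- The preliminary estimator, as a function of the value `x` of the observation at time `τ`:
`α` if `x ≤ x_m(τ)`, `β` if `x ≥ x_M(τ)`, and otherwise a solution `μ ∈ Θ` of `x_τ(μ) = x`. -/
noncomputable def prelim (M : HiddenModel) (τ x : ℝ) : ℝ :=
  if x ≤ M.xInf τ then M.α
  else if M.xSup τ ≤ x then M.β
  else Function.invFunOn (fun ϑ => M.limX ϑ τ) M.Θ x

/-- Under `P`, the processes `(X_t, Y_t)`, `t ∈ [0, T]`, solve the system with parameter `ϑ` and
noise level `ε`, driven by the independent Wiener processes `W` and `V`. -/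
structure IsSystem (M : HiddenModel) (ϑ ε : ℝ) {Ω : Type*} [MeasurableSpace Ω] (P : Measure Ω)
    (W V : ℝ≥0 → Ω → ℝ) (X Y : ℝ → Ω → ℝ) : Prop where
  wiener_W : IsBrownianReal W P
  wiener_V : IsBrownianReal V P
  indep : IndepFun (fun ω t => W t ω) (fun ω t => V t ω) P
  aemeasurable_X : ∀ t ∈ Set.Icc 0 M.T, AEMeasurable (X t) P
  aemeasurable_Y : ∀ t ∈ Set.Icc 0 M.T, AEMeasurable (Y t) P
  continuous_X : ∀ᵐ ω ∂P, ContinuousOn (fun t => X t ω) (Set.Icc 0 M.T)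
  continuous_Y : ∀ᵐ ω ∂P, ContinuousOn (fun t => Y t ω) (Set.Icc 0 M.T)
  state : ∃ J : ℝ → Ω → ℝ, (∀ t ∈ Set.Icc 0 M.T, IsWienerIntegral P V M.b t (J t)) ∧
    ∀ᵐ ω ∂P, ∀ t ∈ Set.Icc 0 M.T,
      Y t ω = M.y₀ + (∫ s in (0 : ℝ)..t, M.a ϑ s * Y s ω) + ε * J t ω
  observation : ∃ J : ℝ → Ω → ℝ, (∀ t ∈ Set.Icc 0 M.T, IsWienerIntegral P W M.σ t (J t)) ∧
    ∀ᵐ ω ∂P, ∀ t ∈ Set.Icc 0 M.T,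
      X t ω = (∫ s in (0 : ℝ)..t, M.f s * Y s ω) + ε * J t ω

end HiddenModel

/-! At a small time `τ` the observation is close to its noiseless limit, and the limit still
distinguishes parameters; the rate is the ratio of the two effects.

Noise: `z = Y - limY` solves `z = ∫ a z + ε J`. When `L τ ≤ 1/2` the drift term is absorbed, so `∫
|z| ≤ 2 ε ∫ |J|` on `[0, τ]` (`integral_abs_le_of_volterra`). The Itô isometry bounds the second
moments of the Wiener integrals by `L² τ`, whence `E (X_τ - x_τ(ϑ₀))² ≤ 4 L² ε² τ`
(`IsSystem.lintegral_sq_sub_limX_le`).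

Separation: near `t = 0` the derivative `aDot` is bounded below uniformly in `ϑ`, so `∫₀ˢ a` grows
in `ϑ` at rate at least of order `s`. One more integration gives `|x_τ(ϑ₂) - x_τ(ϑ₁)| ≥ c τ² |ϑ₂ -
ϑ₁|` up to a constant, since `f` stays near `f 0 ≠ 0` (`exists_mul_sub_le_limX_sub`).

Inverting, the error of the estimator is at most a constant times `|X_τ - x_τ(ϑ₀)| / τ²`. This
includes the values `α`, `β`: they occur only if the deviation is itself of order `τ²`, because `K`
keeps a distance from the boundary of `Θ` (`abs_prelim_sub_le`). The mean square error is thus of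
order `ε² τ / τ⁴`, which is `ε^(2 - 3δ)` for `τ = ε^δ`. Consistency follows by Chebyshev's
inequality. -/

/-! ### Second moments of Wiener integrals. -/

/-- Expanding the product with `E B_s B_t = min s t` leaves four minima, which combine to the length
of the overlap of the two intervals. This is the isometry for a pair of indicators. -/
theorem ProbabilityTheory.IsPreBrownianReal.integral_increment_mul_increment
    {Ω : Type*} [MeasurableSpace Ω] {P : Measure Ω} {B : ℝ≥0 → Ω → ℝ}
    (hB : IsPreBrownianReal B P) {l r l' r' : ℝ≥0} (h : l ≤ r) (h' : l' ≤ r') :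
    ∫ ω, (B r ω - B l ω) * (B r' ω - B l' ω) ∂P
      = max (min (r : ℝ) r' - max (l : ℝ) l') 0 := by
  have hP : IsProbabilityMeasure P := hB.isGaussianProcess.isProbabilityMeasure
  have hm : ∀ t, MemLp (B t) 2 P := fun t =>
    (hB.isGaussianProcess.hasGaussianLaw_eval t).memLp_two
  have hp : ∀ s t, ∫ ω, B s ω * B t ω ∂P = min (s : ℝ) t := by
    intro s t
    have := hB.covariance_eval s t
    rw [covariance_eq_sub (hm s) (hm t), hB.integral_eval, hB.integral_eval] at this
    simpa using this
  have hi : ∀ s t, Integrable (fun ω => B s ω * B t ω) P := fun s t =>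
    (hm s).integrable_mul (hm t)
  have : (fun ω => (B r ω - B l ω) * (B r' ω - B l' ω)) = fun ω =>
      (B r ω * B r' ω - B r ω * B l' ω) - (B l ω * B r' ω - B l ω * B l' ω) := by
    ext ω; ring
  have e1 := integral_sub ((hi r r').sub (hi r l')) ((hi l r').sub (hi l l'))
  simp only [Pi.sub_apply] at e1
  rw [this, e1, integral_sub (hi _ _) (hi _ _),
    integral_sub (hi _ _) (hi _ _), hp, hp, hp, hp]
  have h1 : (l : ℝ) ≤ r := h
  have h2 : (l' : ℝ) ≤ r' := h'
  grind

namespace WienerStep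

theorem memLp_integral {Ω : Type*} [MeasurableSpace Ω] {P : Measure Ω} {B : ℝ≥0 → Ω → ℝ}
    (hB : IsPreBrownianReal B P) (φ : WienerStep) : MemLp (φ.integral B) 2 P := by
  unfold WienerStep.integral
  refine memLp_finsetSum _ fun i _ => MemLp.const_mul ?_ _
  exact ((hB.isGaussianProcess.hasGaussianLaw_eval _).memLp_two).sub
    ((hB.isGaussianProcess.hasGaussianLaw_eval _).memLp_two)

theorem memLp_eval (φ : WienerStep) (t : ℝ) :
    MemLp φ.eval 2 (volume.restrict (Set.Icc 0 t)) := by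
  unfold WienerStep.eval
  refine memLp_finsetSum _ fun i _ => MemLp.const_mul ?_ _
  exact (memLp_const (1 : ℝ)).indicator measurableSet_Ioc

/-- The Itô isometry for step functions. -/
theorem integral_sq_integral {Ω : Type*} [MeasurableSpace Ω] {P : Measure Ω} {B : ℝ≥0 → Ω → ℝ}
    (hB : IsPreBrownianReal B P) (φ : WienerStep) {t : ℝ} (ht : ∀ i, (φ.right i : ℝ) ≤ t) :
    ∫ ω, φ.integral B ω ^ 2 ∂P = ∫ s in Set.Icc 0 t, φ.eval s ^ 2 := by
  have hP : IsProbabilityMeasure P := hB.isGaussianProcess.isProbabilityMeasure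
  have hm : ∀ t, MemLp (B t) 2 P := fun t =>
    (hB.isGaussianProcess.hasGaussianLaw_eval t).memLp_two
  have hmd : ∀ i, MemLp (fun ω => B (φ.right i) ω - B (φ.left i) ω) 2 P := fun i =>
    (hm _).sub (hm _)
  have hme : ∀ i, MemLp ((Set.Ioc (φ.left i : ℝ) (φ.right i : ℝ)).indicator
      (fun _ => (1 : ℝ))) 2 (volume.restrict (Set.Icc 0 t)) := fun i =>
    (memLp_const (1 : ℝ)).indicator measurableSet_Ioc
  have hid : ∀ i j, Integrable (fun ω => φ.coeff i * φ.coeff j *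
      ((B (φ.right i) ω - B (φ.left i) ω) * (B (φ.right j) ω - B (φ.left j) ω))) P := fun i j =>
    ((hmd i).integrable_mul (hmd j)).const_mul _
  have hie : ∀ i j, Integrable (fun s => φ.coeff i * φ.coeff j *
      ((Set.Ioc (φ.left i : ℝ) (φ.right i : ℝ)).indicator (fun _ => (1 : ℝ)) s *
        (Set.Ioc (φ.left j : ℝ) (φ.right j : ℝ)).indicator (fun _ => (1 : ℝ)) s))
      (volume.restrict (Set.Icc 0 t)) := fun i j =>
    ((hme i).integrable_mul (hme j)).const_mul _
  have hsq : ∀ u : Fin φ.n → ℝ, (∑ i, φ.coeff i * u i) ^ 2 =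
      ∑ i, ∑ j, φ.coeff i * φ.coeff j * (u i * u j) := by
    intro u
    rw [sq, Finset.sum_mul_sum]
    exact Finset.sum_congr rfl fun i _ => Finset.sum_congr rfl fun j _ => mul_mul_mul_comm _ _ _ _
  simp only [WienerStep.integral, WienerStep.eval, hsq]
  rw [integral_finsetSum _ fun i _ => integrable_finsetSum _ fun j _ => hid i j,
    integral_finsetSum _ fun i _ => integrable_finsetSum _ fun j _ => hie i j]
  refine Finset.sum_congr rfl fun i _ => ?_
  rw [integral_finsetSum _ fun j _ => hid i j, integral_finsetSum _ fun j _ => hie i j]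
  refine Finset.sum_congr rfl fun j _ => ?_
  rw [integral_const_mul, integral_const_mul,
    hB.integral_increment_mul_increment (φ.le i) (φ.le j)]
  congr 1
  have : (fun s => (Set.Ioc (φ.left i : ℝ) (φ.right i : ℝ)).indicator (fun _ => (1 : ℝ)) s *
      (Set.Ioc (φ.left j : ℝ) (φ.right j : ℝ)).indicator (fun _ => (1 : ℝ)) s) =
      (Set.Ioc (max (φ.left i : ℝ) (φ.left j)) (min (φ.right i : ℝ) (φ.right j))).indicator
        (fun _ => (1 : ℝ)) := by
    ext s
    simp only [← Set.Ioc_inter_Ioc, Set.indicator_apply, Set.mem_inter_iff]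
    split_ifs <;> simp_all
  rw [this, integral_indicator_const _ measurableSet_Ioc, measureReal_restrict_apply measurableSet_Ioc,
    Set.inter_eq_left.2]
  · rw [Measure.real, Real.volume_Ioc, ENNReal.toReal_ofReal', smul_eq_mul, mul_one]
  · intro s hs
    refine ⟨?_, hs.2.trans ((min_le_left _ _).trans (ht i))⟩
    exact ((φ.left i).2.trans (le_max_left _ _)).trans hs.1.le

theorem eLpNorm_integral {Ω : Type*} [MeasurableSpace Ω] {P : Measure Ω} {B : ℝ≥0 → Ω → ℝ}
    (hB : IsPreBrownianReal B P) (φ : WienerStep) {t : ℝ} (ht : ∀ i, (φ.right i : ℝ) ≤ t) :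
    eLpNorm (φ.integral B) 2 P = eLpNorm φ.eval 2 (volume.restrict (Set.Icc 0 t)) := by
  rw [(φ.memLp_integral hB).eLpNorm_eq_integral_rpow_norm two_ne_zero ENNReal.ofNat_ne_top,
    (φ.memLp_eval t).eLpNorm_eq_integral_rpow_norm two_ne_zero ENNReal.ofNat_ne_top]
  simp [integral_sq_integral hB φ ht]

end WienerStep

theorem lintegral_sq_le_of_eLpNorm_two_le {Ω : Type*} [MeasurableSpace Ω] {P : Measure Ω}
    {I : Ω → ℝ} {c : ℝ≥0∞} (h : eLpNorm I 2 P ≤ c) :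
    ∫⁻ ω, ENNReal.ofReal (I ω ^ 2) ∂P ≤ c ^ 2 := by
  have e : ∀ ω, ENNReal.ofReal (I ω ^ 2) = ‖I ω‖ₑ ^ 2 := fun ω => by
    rw [← sq_abs, ENNReal.ofReal_pow (abs_nonneg _), Real.enorm_eq_ofReal_abs]
  have h2 : eLpNorm I 2 P ^ 2 = ∫⁻ ω, ‖I ω‖ₑ ^ 2 ∂P := by
    have := eLpNorm_nnreal_pow_eq_lintegral (f := I) (μ := P) (p := 2) two_ne_zero
    simpa only [NNReal.coe_ofNat, ENNReal.coe_ofNat, ENNReal.rpow_ofNat] using this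
  simp_rw [e, ← h2]
  gcongr

/-- A Wiener integral over `[0, t]` of a function bounded by `L` has second moment at most
`L² t`. -/
theorem IsWienerIntegral.lintegral_sq_le {Ω : Type*} [MeasurableSpace Ω] {P : Measure Ω}
    {B : ℝ≥0 → Ω → ℝ} {g : ℝ → ℝ} {t L : ℝ} {I : Ω → ℝ} (hI : IsWienerIntegral P B g t I)
    (hB : IsPreBrownianReal B P) (ht : 0 ≤ t) (hL : 0 ≤ L)
    (hg : AEMeasurable g (volume.restrict (Set.Icc 0 t)))
    (hgL : ∀ s ∈ Set.Icc 0 t, |g s| ≤ L) :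
    ∫⁻ ω, ENNReal.ofReal (I ω ^ 2) ∂P ≤ ENNReal.ofReal (L ^ 2 * t) := by
  obtain ⟨hIm, φ, hφ, hφg, hφI⟩ := hI
  set μ := volume.restrict (Set.Icc 0 t)
  have hgn : eLpNorm g 2 μ ≤ ENNReal.ofReal t ^ (1 / 2 : ℝ) * ENNReal.ofReal L := by
    refine (eLpNorm_le_of_ae_bound (C := L) ?_).trans (le_of_eq ?_)
    · exact (ae_restrict_mem measurableSet_Icc).mono fun s hs => hgL s hs
    · simp [μ]
  have key : eLpNorm I 2 P ≤ ENNReal.ofReal t ^ (1 / 2 : ℝ) * ENNReal.ofReal L := by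
    -- The isometry turns the norm of the approximating integral into that of the step function;
    -- both approximation errors vanish in the limit, leaving the norm of `g`.
    have hn : ∀ n, eLpNorm I 2 P ≤ eLpNorm (fun ω => (φ n).integral B ω - I ω) 2 P +
        (eLpNorm (fun s => (φ n).eval s - g s) 2 μ + eLpNorm g 2 μ) := by
      intro n
      have h1 : eLpNorm I 2 P ≤ eLpNorm (fun ω => (φ n).integral B ω - I ω) 2 P +
          eLpNorm ((φ n).integral B) 2 P := by
        have hm := ((φ n).memLp_integral hB).aestronglyMeasurable
        have e : I = (φ n).integral B - fun ω => (φ n).integral B ω - I ω := by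
          ext ω; simp
        calc eLpNorm I 2 P = eLpNorm ((φ n).integral B - fun ω => (φ n).integral B ω - I ω) 2 P :=
              by rw [← e]
          _ ≤ _ := (eLpNorm_sub_le hm (hm.sub hIm) one_le_two).trans (le_of_eq (add_comm _ _))
      refine h1.trans (add_le_add le_rfl ?_)
      rw [(φ n).eLpNorm_integral hB (hφ n)]
      have hm := ((φ n).memLp_eval t).aestronglyMeasurable
      have e : (φ n).eval = (fun s => (φ n).eval s - g s) + g := by
        ext s; simp
      calc eLpNorm (φ n).eval 2 μ = eLpNorm ((fun s => (φ n).eval s - g s) + g) 2 μ := by rw [← e]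
        _ ≤ _ := eLpNorm_add_le (hm.sub hg.aestronglyMeasurable) hg.aestronglyMeasurable one_le_two
    have hlim := hφI.add (hφg.add (tendsto_const_nhds (x := eLpNorm g 2 μ)))
    simp only [zero_add] at hlim
    exact (ge_of_tendsto' hlim hn).trans hgn
  refine (lintegral_sq_le_of_eLpNorm_two_le key).trans (le_of_eq ?_)
  rw [mul_pow, ← ENNReal.rpow_natCast, ← ENNReal.rpow_mul, ← ENNReal.ofReal_pow hL,
    mul_comm (L ^ 2), ENNReal.ofReal_mul ht]
  norm_num

/-! ### Exchanging time integral and expectation for a continuous process. -/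

/-- Joint measurability of `G` is not assumed, so Tonelli's theorem does not apply to it. It applies
to discretizations on the grids of mesh `1 / (n + 1)`, which converge to `G` along almost every path
by continuity; Fatou's lemma then passes the bound to the limit. -/
theorem lintegral_lintegral_Icc_le_of_continuousOn {Ω : Type*} [MeasurableSpace Ω]
    {P : Measure Ω} [SFinite P] {G : ℝ → Ω → ℝ≥0∞} {T : ℝ} {C : ℝ≥0∞}
    (hm : ∀ s ∈ Set.Icc 0 T, AEMeasurable (G s) P)
    (hc : ∀ᵐ ω ∂P, ContinuousOn (fun s => G s ω) (Set.Icc 0 T))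
    (hC : ∀ s ∈ Set.Icc 0 T, ∫⁻ ω, G s ω ∂P ≤ C) :
    ∫⁻ ω, (∫⁻ s in Set.Icc 0 T, G s ω) ∂P ≤ C * ENNReal.ofReal T := by
  classical
  -- Measurable versions of `G` at the grid points; the value `0` off `[0, T]` is never used in the
  -- integrals.
  let H : ℕ → ℕ → Ω → ℝ≥0∞ := fun n k =>
    if h : (k : ℝ) / (n + 1 : ℕ) ∈ Set.Icc 0 T then (hm _ h).mk else 0
  have hHm : ∀ n k, Measurable (H n k) := by
    intro n k
    by_cases h : (k : ℝ) / (n + 1 : ℕ) ∈ Set.Icc 0 T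
    · rw [show H n k = (hm _ h).mk from dif_pos h]; exact (hm _ h).measurable_mk
    · rw [show H n k = 0 from dif_neg h]; exact measurable_zero
  have hHG : ∀ᵐ ω ∂P, ∀ n k : ℕ, (k : ℝ) / (n + 1 : ℕ) ∈ Set.Icc 0 T →
      H n k ω = G ((k : ℝ) / (n + 1 : ℕ)) ω := by
    rw [ae_all_iff]; intro n
    rw [ae_all_iff]; intro k
    by_cases h : (k : ℝ) / (n + 1 : ℕ) ∈ Set.Icc 0 T
    · filter_upwards [(hm _ h).ae_eq_mk] with ω hω _
      rw [show H n k = (hm _ h).mk from dif_pos h]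
      exact hω.symm
    · exact Eventually.of_forall fun ω h' => absurd h' h
  clear_value H
  -- Time is rounded down, so that the grid point stays in `[0, T]`.
  let F : ℕ → Ω → ℝ → ℝ≥0∞ := fun n ω s => H n ⌊s * (n + 1 : ℕ)⌋₊ ω
  have hFm : ∀ n, Measurable (Function.uncurry (F n)) := by
    intro n
    have h1 : Measurable (fun p : ℕ × Ω => H n p.1 p.2) :=
      measurable_from_prod_countable_right fun k => hHm n k
    have h2 : Measurable (fun p : Ω × ℝ => (⌊p.2 * (n + 1 : ℕ)⌋₊, p.1)) := by fun_prop
    exact h1.comp h2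
  have hmem : ∀ (n : ℕ), ∀ s ∈ Set.Icc 0 T,
      (⌊s * (n + 1 : ℕ)⌋₊ : ℝ) / (n + 1 : ℕ) ∈ Set.Icc 0 T := by
    intro n s hs
    have hn : (0 : ℝ) < (n + 1 : ℕ) := by positivity
    refine ⟨by positivity, le_trans ?_ hs.2⟩
    rw [div_le_iff₀ hn]
    exact Nat.floor_le (mul_nonneg hs.1 hn.le)
  have hFC : ∀ n, ∀ s ∈ Set.Icc 0 T, ∫⁻ ω, F n ω s ∂P ≤ C := by
    intro n s hs
    refine le_trans (le_of_eq (lintegral_congr_ae ?_)) (hC _ (hmem n s hs))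
    filter_upwards [hHG] with ω hω
    exact hω _ _ (hmem n s hs)
  have hlim : ∀ᵐ ω ∂P, ∀ s ∈ Set.Icc 0 T, G s ω = liminf (fun n => F n ω s) atTop := by
    filter_upwards [hHG, hc] with ω hω hcω s hs
    have h1 : Tendsto (fun n : ℕ => (⌊s * (n + 1 : ℕ)⌋₊ : ℝ) / (n + 1 : ℕ)) atTop (𝓝 s) :=
      (tendsto_nat_floor_mul_div_atTop hs.1).comp
        (tendsto_natCast_atTop_atTop.comp (tendsto_add_atTop_nat 1))
    have h2 : Tendsto (fun n => F n ω s) atTop (𝓝 (G s ω)) := by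
      have h3 := (hcω s hs).tendsto.comp (tendsto_nhdsWithin_iff.2
        ⟨h1, Eventually.of_forall fun n => hmem n s hs⟩)
      refine h3.congr fun n => ?_
      exact (hω _ _ (hmem n s hs)).symm
    exact h2.liminf_eq.symm
  calc ∫⁻ ω, (∫⁻ s in Set.Icc 0 T, G s ω) ∂P
      = ∫⁻ ω, (∫⁻ s in Set.Icc 0 T, liminf (fun n => F n ω s) atTop) ∂P := by
        refine lintegral_congr_ae ?_
        filter_upwards [hlim] with ω hω
        exact setLIntegral_congr_fun measurableSet_Icc hω
    _ = ∫⁻ s in Set.Icc 0 T, ∫⁻ ω, liminf (fun n => F n ω s) atTop ∂P :=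
        lintegral_lintegral_swap (Measurable.liminf hFm).aemeasurable
    _ ≤ ∫⁻ s in Set.Icc 0 T, C := by
        refine setLIntegral_mono measurable_const fun s hs => ?_
        refine (lintegral_liminf_le fun n => (hFm n).comp measurable_prodMk_right).trans ?_
        refine liminf_le_of_le (by isBoundedDefault) fun b hb => ?_
        obtain ⟨n, hn⟩ := hb.exists
        exact hn.trans (hFC n s hs)
    _ = C * ENNReal.ofReal T := by simp

/-! ### Linear integral equations with bounded measurable coefficients. -/

theorem intervalIntegrable_of_bounded {a : ℝ → ℝ} {T L s t : ℝ}
    (ha : AEMeasurable a (volume.restrict (Set.Icc 0 T))) (hL : ∀ r ∈ Set.Icc 0 T, |a r| ≤ L)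
    (hs : s ∈ Set.Icc 0 T) (ht : t ∈ Set.Icc 0 T) : IntervalIntegrable a volume s t := by
  have h : IntegrableOn a (Set.Icc 0 T) :=
    Integrable.of_bound ha.aestronglyMeasurable L
      ((ae_restrict_mem measurableSet_Icc).mono fun r hr => hL r hr)
  refine intervalIntegrable_iff.2 (h.mono_set ?_)
  exact Set.uIoc_subset_uIcc.trans (Set.uIcc_subset_Icc hs ht)

theorem lipschitzOnWith_integral_of_bounded {a : ℝ → ℝ} {T L : ℝ} (hL0 : 0 ≤ L)
    (ha : AEMeasurable a (volume.restrict (Set.Icc 0 T))) (hL : ∀ r ∈ Set.Icc 0 T, |a r| ≤ L) :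
    LipschitzOnWith L.toNNReal (fun t => ∫ r in (0 : ℝ)..t, a r) (Set.Icc 0 T) := by
  refine LipschitzOnWith.of_dist_le_mul fun x hx y hy => ?_
  have h0 : (0 : ℝ) ∈ Set.Icc 0 T := ⟨le_rfl, hx.1.trans hx.2⟩
  rw [Real.dist_eq, Real.dist_eq, intervalIntegral.integral_interval_sub_left
    (intervalIntegrable_of_bounded ha hL h0 hx) (intervalIntegrable_of_bounded ha hL h0 hy),
    Real.coe_toNNReal L hL0]
  refine intervalIntegral.norm_integral_le_of_norm_le_const (f := a) fun r hr => ?_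
  refine hL r ?_
  exact Set.uIcc_subset_Icc hy hx (Set.uIoc_subset_uIcc hr)

/-- As `a` is only measurable, `∫ a` need not be `C¹`. It is Lipschitz, so its exponential is
absolutely continuous and is recovered from its almost everywhere derivative. -/
theorem exp_integral_eq_one_add_integral {a : ℝ → ℝ} {T L t : ℝ}
    (ha : AEMeasurable a (volume.restrict (Set.Icc 0 T))) (hL0 : 0 ≤ L)
    (hL : ∀ r ∈ Set.Icc 0 T, |a r| ≤ L) (ht : t ∈ Set.Icc 0 T) :
    Real.exp (∫ r in (0 : ℝ)..t, a r) =
      1 + ∫ s in (0 : ℝ)..t, a s * Real.exp (∫ r in (0 : ℝ)..s, a r) := by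
  have hsub : Set.uIcc 0 t ⊆ Set.Icc 0 T := by
    rw [Set.uIcc_of_le ht.1]; exact Set.Icc_subset_Icc_right ht.2
  have h0 : (0 : ℝ) ∈ Set.Icc 0 T := ⟨le_rfl, ht.1.trans ht.2⟩
  have hF := lipschitzOnWith_integral_of_bounded hL0 ha hL
  -- The exponential is Lipschitz only on bounded sets; `[-LT, LT]` contains all values of `∫ a`.
  obtain ⟨K, hK⟩ := (Real.contDiff_exp (n := 1)).contDiffOn.exists_lipschitzOnWith
    (s := Set.Icc (-(L * T)) (L * T)) (by decide) (convex_Icc _ _) isCompact_Icc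
  have hmaps : Set.MapsTo (fun t => ∫ r in (0 : ℝ)..t, a r) (Set.Icc 0 T)
      (Set.Icc (-(L * T)) (L * T)) := by
    intro s hs
    have := hF.dist_le_mul s hs 0 h0
    simp only [Real.dist_eq, intervalIntegral.integral_same, sub_zero, abs_of_nonneg hs.1,
      Real.coe_toNNReal L hL0] at this
    exact abs_le.1 (this.trans (mul_le_mul_of_nonneg_left hs.2 hL0))
  have hac : AbsolutelyContinuousOnInterval
      (fun s => Real.exp (∫ r in (0 : ℝ)..s, a r)) 0 t :=
    ((hK.comp hF hmaps).mono hsub).absolutelyContinuousOnInterval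
  have h1 := hac.integral_deriv_eq_sub
  simp only [intervalIntegral.integral_same, Real.exp_zero] at h1
  have h2 : ∫ s in (0 : ℝ)..t, deriv (fun s => Real.exp (∫ r in (0 : ℝ)..s, a r)) s =
      ∫ s in (0 : ℝ)..t, a s * Real.exp (∫ r in (0 : ℝ)..s, a r) := by
    refine intervalIntegral.integral_congr_ae ?_
    filter_upwards [(intervalIntegrable_of_bounded ha hL h0 ht).ae_hasDerivAt_integral]
      with s hs hs'
    rw [(hs (Set.uIoc_subset_uIcc hs') 0 Set.left_mem_uIcc).exp.deriv, mul_comm]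
  linarith

/-- Cauchy–Schwarz, by integrating `(|j| - S / τ)² ≥ 0`, where `S / τ` is the mean of `|j|`. -/
theorem sq_integral_abs_le {j : ℝ → ℝ} {τ : ℝ} (hτ : 0 < τ) (hj : ContinuousOn j (Set.Icc 0 τ)) :
    (∫ s in (0 : ℝ)..τ, |j s|) ^ 2 ≤ τ * ∫ s in (0 : ℝ)..τ, j s ^ 2 := by
  have hi1 : IntervalIntegrable (fun s => |j s|) volume 0 τ :=
    hj.abs.intervalIntegrable_of_Icc hτ.le
  have hi2 : IntervalIntegrable (fun s => j s ^ 2) volume 0 τ :=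
    (hj.pow 2).intervalIntegrable_of_Icc hτ.le
  set S := ∫ s in (0 : ℝ)..τ, |j s|
  have h0 : 0 ≤ ∫ s in (0 : ℝ)..τ, (j s ^ 2 - (2 * (S / τ)) * |j s|) + (S / τ) ^ 2 :=
    intervalIntegral.integral_nonneg hτ.le fun s _ => by
      have := sq_nonneg (|j s| - S / τ)
      rw [← sq_abs (j s)]; linarith
  rw [intervalIntegral.integral_add (hi2.sub (hi1.const_mul _)) (by simp),
    intervalIntegral.integral_sub hi2 (hi1.const_mul _), intervalIntegral.integral_const_mul,
    intervalIntegral.integral_const] at h0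
  have h1 : S ^ 2 / τ ≤ ∫ s in (0 : ℝ)..τ, j s ^ 2 := by
    have : (τ - 0) • (S / τ) ^ 2 = S ^ 2 / τ := by simp; field_simp
    have h3 : 2 * (S / τ) * S = 2 * (S ^ 2 / τ) := by ring
    linarith
  rw [div_le_iff₀ hτ] at h1
  linarith

/-- A bound for the linear Volterra equation `z = ∫ a z + ε j` on a short interval. -/
theorem integral_abs_le_of_volterra {a z j : ℝ → ℝ} {L τ ε : ℝ} (hτ : 0 < τ) (hε : 0 < ε)
    (hL0 : 0 ≤ L) (ha : AEMeasurable a (volume.restrict (Set.Icc 0 τ)))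
    (hL : ∀ r ∈ Set.Icc 0 τ, |a r| ≤ L) (hLτ : L * τ ≤ 1 / 2) (hz : ContinuousOn z (Set.Icc 0 τ))
    (h : ∀ t ∈ Set.Icc 0 τ, z t = (∫ s in (0 : ℝ)..t, a s * z s) + ε * j t) :
    ContinuousOn j (Set.Icc 0 τ) ∧
      ∫ s in (0 : ℝ)..τ, |z s| ≤ 2 * ε * ∫ s in (0 : ℝ)..τ, |j s| := by
  obtain ⟨D, hD⟩ := isCompact_Icc.exists_bound_of_continuousOn hz
  have hD0 : 0 ≤ D := (norm_nonneg _).trans (hD 0 ⟨le_rfl, hτ.le⟩)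
  have hazm : AEMeasurable (fun s => a s * z s) (volume.restrict (Set.Icc 0 τ)) :=
    ha.mul (hz.aemeasurable measurableSet_Icc)
  have hazL : ∀ r ∈ Set.Icc 0 τ, |a r * z r| ≤ L * D := fun r hr => by
    rw [abs_mul]
    exact mul_le_mul (hL r hr) (hD r hr) (abs_nonneg _) hL0
  have h0 : (0 : ℝ) ∈ Set.Icc 0 τ := ⟨le_rfl, hτ.le⟩
  -- Continuity of the noise comes from the equation itself: `j = ε⁻¹ (z - ∫ a z)`.
  have hjc : ContinuousOn j (Set.Icc 0 τ) := by
    have hF := (lipschitzOnWith_integral_of_bounded (mul_nonneg hL0 hD0) hazm hazL).continuousOn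
    refine (continuousOn_const (c := ε⁻¹).mul (hz.sub hF)).congr fun t ht => ?_
    simp only [Pi.mul_apply, Pi.sub_apply]
    rw [h t ht]
    field_simp
    ring
  refine ⟨hjc, ?_⟩
  have hiz : IntervalIntegrable (fun s => |z s|) volume 0 τ := hz.abs.intervalIntegrable_of_Icc hτ.le
  have hij : IntervalIntegrable (fun s => |j s|) volume 0 τ := hjc.abs.intervalIntegrable_of_Icc hτ.le
  set A := ∫ s in (0 : ℝ)..τ, |z s| with hA
  have hA0 : 0 ≤ A := intervalIntegral.integral_nonneg hτ.le fun s _ => abs_nonneg _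
  have hpt : ∀ t ∈ Set.Icc 0 τ, |z t| ≤ L * A + ε * |j t| := by
    intro t ht
    have h1 : |∫ s in (0 : ℝ)..t, a s * z s| ≤ L * A := by
      calc |∫ s in (0 : ℝ)..t, a s * z s| ≤ ∫ s in (0 : ℝ)..t, L * |z s| := by
            rw [← Real.norm_eq_abs]
            refine intervalIntegral.norm_integral_le_of_norm_le ht.1 ?_
              (((hz.abs.mono (Set.Icc_subset_Icc_right ht.2)).intervalIntegrable_of_Icc
                (μ := volume) ht.1).const_mul L)
            refine Eventually.of_forall fun s hs => ?_
            rw [Real.norm_eq_abs, abs_mul]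
            exact mul_le_mul_of_nonneg_right (hL s ⟨hs.1.le, hs.2.trans ht.2⟩) (abs_nonneg _)
        _ = L * ∫ s in (0 : ℝ)..t, |z s| := intervalIntegral.integral_const_mul _ _
        _ ≤ L * A := by
            refine mul_le_mul_of_nonneg_left ?_ hL0
            exact intervalIntegral.integral_mono_interval le_rfl ht.1 ht.2
              (Eventually.of_forall fun s => abs_nonneg _) hiz
    calc |z t| = |(∫ s in (0 : ℝ)..t, a s * z s) + ε * j t| := by rw [← h t ht]
      _ ≤ |∫ s in (0 : ℝ)..t, a s * z s| + |ε * j t| := abs_add_le _ _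
      _ ≤ L * A + ε * |j t| := by rw [abs_mul, abs_of_pos hε]; linarith
  -- Integration gives `A ≤ L τ A + ε ∫ |j|`, and `L τ ≤ 1/2` absorbs the first term, so no Gronwall
  -- argument is needed.
  have h2 : A ≤ ∫ s in (0 : ℝ)..τ, (L * A + ε * |j s|) :=
    intervalIntegral.integral_mono_on hτ.le hiz ((intervalIntegrable_const (μ := volume)).add (hij.const_mul ε)) hpt
  rw [intervalIntegral.integral_add (by simp) (hij.const_mul ε),
    intervalIntegral.integral_const] at h2
  rw [intervalIntegral.integral_const_mul, sub_zero, smul_eq_mul] at h2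
  nlinarith

/-! ### Deviation of the observation from its noiseless limit. -/

namespace HiddenModel

variable {M : HiddenModel}

theorem continuousOn_limY {ϑ L : ℝ} (hL0 : 0 ≤ L)
    (ha : AEMeasurable (M.a ϑ) (volume.restrict (Set.Icc 0 M.T)))
    (hL : ∀ r ∈ Set.Icc 0 M.T, |M.a ϑ r| ≤ L) : ContinuousOn (M.limY ϑ) (Set.Icc 0 M.T) :=
  continuousOn_const.mul
    (lipschitzOnWith_integral_of_bounded hL0 ha hL).continuousOn.rexp

theorem intervalIntegrable_mul_continuousOn {g y : ℝ → ℝ} {T L t : ℝ} (hL0 : 0 ≤ L)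
    (hg : AEMeasurable g (volume.restrict (Set.Icc 0 T)))
    (hL : ∀ r ∈ Set.Icc 0 T, |g r| ≤ L) (hy : ContinuousOn y (Set.Icc 0 T))
    (ht : t ∈ Set.Icc 0 T) : IntervalIntegrable (fun s => g s * y s) volume 0 t := by
  obtain ⟨D, hD⟩ := isCompact_Icc.exists_bound_of_continuousOn hy
  refine intervalIntegrable_of_bounded (L := L * D) (hg.mul (hy.aemeasurable measurableSet_Icc))
    (fun r hr => ?_) ⟨le_rfl, ht.1.trans ht.2⟩ ht
  rw [abs_mul]
  exact mul_le_mul (hL r hr) (hD r hr) (abs_nonneg _) hL0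

/-- The path-by-path comparison of the observation with its noiseless limit. -/
theorem sq_sub_limX_le {ϑ L τ ε x : ℝ} {y j j' : ℝ → ℝ} (hτ : 0 < τ) (hτT : τ ≤ M.T) (hε : 0 < ε)
    (hL0 : 0 ≤ L) (hLτ : L * τ ≤ 1 / 2)
    (hf : AEMeasurable M.f (volume.restrict (Set.Icc 0 M.T)))
    (hfL : ∀ r ∈ Set.Icc 0 M.T, |M.f r| ≤ L)
    (ha : AEMeasurable (M.a ϑ) (volume.restrict (Set.Icc 0 M.T)))
    (haL : ∀ r ∈ Set.Icc 0 M.T, |M.a ϑ r| ≤ L) (hy : ContinuousOn y (Set.Icc 0 M.T))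
    (hstate : ∀ t ∈ Set.Icc 0 M.T,
      y t = M.y₀ + (∫ s in (0 : ℝ)..t, M.a ϑ s * y s) + ε * j t)
    (hobs : x = (∫ s in (0 : ℝ)..τ, M.f s * y s) + ε * j' τ) :
    ContinuousOn j (Set.Icc 0 τ) ∧
      (x - M.limX ϑ τ) ^ 2 ≤
        8 * L ^ 2 * ε ^ 2 * τ * (∫ s in (0 : ℝ)..τ, j s ^ 2) + 2 * ε ^ 2 * j' τ ^ 2 := by
  have hsub : Set.Icc 0 τ ⊆ Set.Icc 0 M.T := Set.Icc_subset_Icc_right hτT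
  have hτm : τ ∈ Set.Icc 0 M.T := ⟨hτ.le, hτT⟩
  have hlimY := continuousOn_limY hL0 ha haL
  have hz : ContinuousOn (fun s => y s - M.limY ϑ s) (Set.Icc 0 M.T) := hy.sub hlimY
  have hlimeq : ∀ t ∈ Set.Icc 0 M.T,
      M.limY ϑ t = M.y₀ + ∫ s in (0 : ℝ)..t, M.a ϑ s * M.limY ϑ s := by
    intro t ht
    simp only [limY]
    rw [exp_integral_eq_one_add_integral ha hL0 haL ht, mul_add, mul_one,
      ← intervalIntegral.integral_const_mul]
    congr 1
    exact intervalIntegral.integral_congr fun s _ => by ring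
  -- By linearity the initial value cancels, and the difference is driven by the noise alone.
  have hzeq : ∀ t ∈ Set.Icc 0 τ, y t - M.limY ϑ t =
      (∫ s in (0 : ℝ)..t, M.a ϑ s * (y s - M.limY ϑ s)) + ε * j t := by
    intro t ht
    simp only [mul_sub]
    rw [intervalIntegral.integral_sub
      (intervalIntegrable_mul_continuousOn hL0 ha haL hy (hsub ht))
      (intervalIntegrable_mul_continuousOn hL0 ha haL hlimY (hsub ht))]
    linarith [hstate t (hsub ht), hlimeq t (hsub ht)]
  obtain ⟨hjc, hA⟩ := integral_abs_le_of_volterra hτ hε hL0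
    (ha.mono_measure (Measure.restrict_mono hsub le_rfl)) (fun r hr => haL r (hsub hr)) hLτ
    (hz.mono hsub) hzeq
  refine ⟨hjc, ?_⟩
  have hx : x - M.limX ϑ τ = (∫ s in (0 : ℝ)..τ, M.f s * (y s - M.limY ϑ s)) + ε * j' τ := by
    simp only [mul_sub]
    rw [intervalIntegral.integral_sub
      (intervalIntegrable_mul_continuousOn hL0 hf hfL hy hτm)
      (intervalIntegrable_mul_continuousOn hL0 hf hfL hlimY hτm), hobs, limX]
    ring
  have hb : |∫ s in (0 : ℝ)..τ, M.f s * (y s - M.limY ϑ s)| ≤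
      2 * L * ε * ∫ s in (0 : ℝ)..τ, |j s| := by
    calc |∫ s in (0 : ℝ)..τ, M.f s * (y s - M.limY ϑ s)|
        ≤ ∫ s in (0 : ℝ)..τ, L * |y s - M.limY ϑ s| := by
          rw [← Real.norm_eq_abs]
          refine intervalIntegral.norm_integral_le_of_norm_le hτ.le ?_
            (((hz.mono hsub).abs.intervalIntegrable_of_Icc (μ := volume) hτ.le).const_mul L)
          refine Eventually.of_forall fun s hs => ?_
          rw [Real.norm_eq_abs, abs_mul]
          exact mul_le_mul_of_nonneg_right (hfL s ⟨hs.1.le, hs.2.trans hτT⟩) (abs_nonneg _)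
      _ = L * ∫ s in (0 : ℝ)..τ, |y s - M.limY ϑ s| := intervalIntegral.integral_const_mul _ _
      _ ≤ L * (2 * ε * ∫ s in (0 : ℝ)..τ, |j s|) := mul_le_mul_of_nonneg_left hA hL0
      _ = _ := by ring
  have hcs := sq_integral_abs_le hτ hjc
  set S := ∫ s in (0 : ℝ)..τ, |j s|
  set Q := ∫ s in (0 : ℝ)..τ, j s ^ 2
  set I := ∫ s in (0 : ℝ)..τ, M.f s * (y s - M.limY ϑ s)
  have hI2 : I ^ 2 ≤ 4 * L ^ 2 * ε ^ 2 * (τ * Q) := by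
    calc I ^ 2 = |I| ^ 2 := (sq_abs I).symm
      _ ≤ (2 * L * ε * S) ^ 2 := pow_le_pow_left₀ (abs_nonneg _) hb 2
      _ = 4 * L ^ 2 * ε ^ 2 * S ^ 2 := by ring
      _ ≤ _ := mul_le_mul_of_nonneg_left hcs (by positivity)
  rw [hx]
  linarith [sq_nonneg (I - ε * j' τ)]

/-- The mean square deviation of the observation at a small time from its noiseless limit. -/
theorem IsSystem.lintegral_sq_sub_limX_le {ϑ ε L τ : ℝ} {Ω : Type*} [MeasurableSpace Ω]
    {P : Measure Ω} {W V : ℝ≥0 → Ω → ℝ} {X Y : ℝ → Ω → ℝ} (h : M.IsSystem ϑ ε P W V X Y)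
    (hM : M.BoundedCoefficients) (hϑ : ϑ ∈ M.Θ) (hε : 0 < ε) (hτ : 0 < τ) (hτT : τ ≤ M.T)
    (hL0 : 0 ≤ L) (hLτ : L * τ ≤ 1 / 2)
    (hL : ∀ t ∈ Set.Icc 0 M.T,
      |M.f t| ≤ L ∧ |M.σ t| ≤ L ∧ |M.b t| ≤ L ∧ ∀ ϑ ∈ M.Θ, |M.a ϑ t| ≤ L) :
    ∫⁻ ω, ENNReal.ofReal ((X τ ω - M.limX ϑ τ) ^ 2) ∂P ≤
      ENNReal.ofReal (4 * L ^ 2 * ε ^ 2 * τ) := by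
  obtain ⟨J, hJ, hstate⟩ := h.state
  obtain ⟨J', hJ', hobs⟩ := h.observation
  have hB := h.wiener_W.toIsPreBrownianReal
  have hP : IsProbabilityMeasure P := hB.isGaussianProcess.isProbabilityMeasure
  have hsub : Set.Icc 0 τ ⊆ Set.Icc 0 M.T := Set.Icc_subset_Icc_right hτT
  have hτm : τ ∈ Set.Icc 0 M.T := ⟨hτ.le, hτT⟩
  have hpath : ∀ᵐ ω ∂P, ContinuousOn (fun s => J s ω) (Set.Icc 0 τ) ∧
      (X τ ω - M.limX ϑ τ) ^ 2 ≤ 8 * L ^ 2 * ε ^ 2 * τ * (∫ s in (0 : ℝ)..τ, J s ω ^ 2) +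
        2 * ε ^ 2 * J' τ ω ^ 2 := by
    filter_upwards [hstate, hobs, h.continuous_Y] with ω h1 h2 h3
    exact sq_sub_limX_le (j := fun s => J s ω) (j' := fun s => J' s ω) hτ hτT hε hL0 hLτ
      hM.aemeasurable_f (fun r hr => (hL r hr).1) (hM.aemeasurable_a ϑ hϑ)
      (fun r hr => (hL r hr).2.2.2 ϑ hϑ) h3 h1 (h2 τ hτm)
  have hJ2 : ∀ s ∈ Set.Icc 0 τ,
      ∫⁻ ω, ENNReal.ofReal (J s ω ^ 2) ∂P ≤ ENNReal.ofReal (L ^ 2 * τ) := by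
    intro s hs
    have hss : Set.Icc 0 s ⊆ Set.Icc 0 M.T := Set.Icc_subset_Icc_right (hsub hs).2
    refine ((hJ s (hsub hs)).lintegral_sq_le h.wiener_V.toIsPreBrownianReal hs.1 hL0
      (hM.aemeasurable_b.mono_measure (Measure.restrict_mono hss le_rfl))
      (fun r hr => (hL r (hss hr)).2.2.1)).trans ?_
    exact ENNReal.ofReal_le_ofReal (mul_le_mul_of_nonneg_left hs.2 (sq_nonneg L))
  have hJ'2 : ∫⁻ ω, ENNReal.ofReal (J' τ ω ^ 2) ∂P ≤ ENNReal.ofReal (L ^ 2 * τ) :=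
    (hJ' τ hτm).lintegral_sq_le h.wiener_W.toIsPreBrownianReal hτ.le hL0
      (hM.aemeasurable_σ.mono_measure (Measure.restrict_mono hsub le_rfl))
      (fun r hr => (hL r (hsub hr)).2.1)
  have hfub : ∫⁻ ω, (∫⁻ s in Set.Icc 0 τ, ENNReal.ofReal (J s ω ^ 2)) ∂P ≤
      ENNReal.ofReal (L ^ 2 * τ) * ENNReal.ofReal τ := by
    refine lintegral_lintegral_Icc_le_of_continuousOn
      (G := fun s ω => ENNReal.ofReal (J s ω ^ 2)) (fun s hs => ?_) ?_ hJ2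
    · exact ((hJ s (hsub hs)).1.aemeasurable.pow_const 2).ennreal_ofReal
    · filter_upwards [hpath] with ω hω
      exact ENNReal.continuous_ofReal.comp_continuousOn (hω.1.pow 2)
  calc ∫⁻ ω, ENNReal.ofReal ((X τ ω - M.limX ϑ τ) ^ 2) ∂P
      ≤ ∫⁻ ω, (ENNReal.ofReal (8 * L ^ 2 * ε ^ 2 * τ) *
          (∫⁻ s in Set.Icc 0 τ, ENNReal.ofReal (J s ω ^ 2)) +
          ENNReal.ofReal (2 * ε ^ 2) * ENNReal.ofReal (J' τ ω ^ 2)) ∂P := by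
        refine lintegral_mono_ae ?_
        filter_upwards [hpath] with ω hω
        refine (ENNReal.ofReal_le_ofReal hω.2).trans (le_of_eq ?_)
        have hJi : IntegrableOn (fun s => J s ω ^ 2) (Set.Icc 0 τ) :=
          (hω.1.pow 2).integrableOn_Icc
        have hnn : 0 ≤ ∫ s in (0 : ℝ)..τ, J s ω ^ 2 :=
          intervalIntegral.integral_nonneg hτ.le fun s _ => sq_nonneg _
        rw [ENNReal.ofReal_add (by positivity) (by positivity), 
          ENNReal.ofReal_mul (p := 8 * L ^ 2 * ε ^ 2 * τ) (by positivity),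
          ENNReal.ofReal_mul (p := 2 * ε ^ 2) (by positivity), intervalIntegral.integral_of_le hτ.le,
          ← integral_Icc_eq_integral_Ioc, ofReal_integral_eq_lintegral_ofReal hJi
          (Eventually.of_forall fun s => sq_nonneg _)]
    _ = ENNReal.ofReal (8 * L ^ 2 * ε ^ 2 * τ) *
          (∫⁻ ω, (∫⁻ s in Set.Icc 0 τ, ENNReal.ofReal (J s ω ^ 2)) ∂P) +
          ENNReal.ofReal (2 * ε ^ 2) * ∫⁻ ω, ENNReal.ofReal (J' τ ω ^ 2) ∂P := by
        have hm : AEMeasurable (fun ω => ENNReal.ofReal (2 * ε ^ 2) *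
            ENNReal.ofReal (J' τ ω ^ 2)) P :=
          (((hJ' τ hτm).1.aemeasurable.pow_const 2).ennreal_ofReal).const_mul _
        rw [lintegral_add_right' _ hm, lintegral_const_mul' _ _ ENNReal.ofReal_ne_top,
          lintegral_const_mul' _ _ ENNReal.ofReal_ne_top]
    _ ≤ ENNReal.ofReal (8 * L ^ 2 * ε ^ 2 * τ) *
          (ENNReal.ofReal (L ^ 2 * τ) * ENNReal.ofReal τ) +
          ENNReal.ofReal (2 * ε ^ 2) * ENNReal.ofReal (L ^ 2 * τ) := by gcongr
    _ = ENNReal.ofReal (8 * L ^ 2 * ε ^ 2 * τ * (L ^ 2 * τ * τ) + 2 * ε ^ 2 * (L ^ 2 * τ)) := by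
        rw [ENNReal.ofReal_add (by positivity) (by positivity),
          ENNReal.ofReal_mul (p := 8 * L ^ 2 * ε ^ 2 * τ) (by positivity),
          ENNReal.ofReal_mul (p := L ^ 2 * τ) (by positivity),
          ENNReal.ofReal_mul (p := 2 * ε ^ 2) (by positivity)]
    -- The state noise contributes `8 L² ε² τ (L τ)²`, at most `2 L² ε² τ` because `L τ ≤ 1/2`; the
    -- observation noise contributes another `2 L² ε² τ`.
    _ ≤ ENNReal.ofReal (4 * L ^ 2 * ε ^ 2 * τ) := by
        refine ENNReal.ofReal_le_ofReal ?_
        have h1 : (L * τ) ^ 2 ≤ (1 / 2) ^ 2 := pow_le_pow_left₀ (by positivity) hLτ 2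
        have h2 : 0 ≤ 8 * L ^ 2 * ε ^ 2 * τ := by positivity
        nlinarith [mul_le_mul_of_nonneg_left h1 h2]

end HiddenModel

/-! ### Separation of parameters by the noiseless observation. -/

namespace HiddenModel

variable {M : HiddenModel}

/-- Uniform convergence at `t = 0` keeps `aDot` above half of its lower bound at time `0`, for all
`ϑ` at once; the mean value inequality does the rest. -/
theorem exists_mul_sub_le_drift_sub (hM : M.SmoothDrift) (hM' : M.SeparatedFromZero) :
    ∃ c > 0, ∃ t₀ > 0, ∀ t ∈ Set.Ioo 0 t₀, t ≤ M.T → ∀ ϑ₁ ∈ M.Θ, ∀ ϑ₂ ∈ M.Θ, ϑ₁ ≤ ϑ₂ →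
      c * (ϑ₂ - ϑ₁) ≤ M.a ϑ₂ t - M.a ϑ₁ t := by
  obtain ⟨c, hc, hca⟩ := hM'.2
  have h := Metric.tendstoUniformlyOn_iff.1 hM.uniform_zero (c / 2) (by positivity)
  obtain ⟨t₀, ht₀, h⟩ := mem_nhdsGT_iff_exists_Ioo_subset.1 h
  refine ⟨c / 2, by positivity, t₀, ht₀, fun t ht htT ϑ₁ h₁ ϑ₂ h₂ h₁₂ => ?_⟩
  have hcd := hM.contDiff_ϑ t ⟨ht.1.le, htT⟩
  refine (convex_Ioo M.α M.β).mul_sub_le_image_sub_of_le_deriv (f := fun ϑ => M.a ϑ t)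
    hcd.continuousOn ((hcd.differentiableOn one_ne_zero).mono interior_subset) (fun ϑ hϑ => ?_)
    ϑ₁ h₁ ϑ₂ h₂ h₁₂
  have h1 := h ht ϑ (interior_subset hϑ)
  have h2 := hca ϑ (interior_subset hϑ)
  rw [Real.dist_eq, abs_lt] at h1
  change c / 2 ≤ M.aDot ϑ t
  linarith [h1.2]

theorem abs_integral_drift_le {ϑ L s : ℝ}
    (hL : ∀ r ∈ Set.Icc 0 M.T, |M.a ϑ r| ≤ L) (hs : s ∈ Set.Icc 0 M.T) :
    |∫ r in (0 : ℝ)..s, M.a ϑ r| ≤ L * M.T := by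
  have hL0 : 0 ≤ L := (abs_nonneg _).trans (hL 0 ⟨le_rfl, hs.1.trans hs.2⟩)
  have h1 : ‖∫ r in (0 : ℝ)..s, M.a ϑ r‖ ≤ L * |s - 0| := by
    refine intervalIntegral.norm_integral_le_of_norm_le_const fun r hr => ?_
    rw [Set.uIoc_of_le hs.1] at hr
    exact hL r ⟨hr.1.le, hr.2.trans hs.2⟩
  rw [sub_zero, abs_of_nonneg hs.1] at h1
  exact h1.trans (mul_le_mul_of_nonneg_left hs.2 hL0)

theorem abs_limY_le {ϑ L s : ℝ}
    (hL : ∀ r ∈ Set.Icc 0 M.T, |M.a ϑ r| ≤ L) (hs : s ∈ Set.Icc 0 M.T) :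
    |M.limY ϑ s| ≤ |M.y₀| * Real.exp (L * M.T) := by
  rw [limY, abs_mul, Real.abs_exp]
  gcongr
  exact (le_abs_self _).trans (abs_integral_drift_le hL hs)

theorem abs_limX_le {ϑ L t : ℝ} (hfL : ∀ r ∈ Set.Icc 0 M.T, |M.f r| ≤ L)
    (hL : ∀ r ∈ Set.Icc 0 M.T, |M.a ϑ r| ≤ L) (ht : t ∈ Set.Icc 0 M.T) :
    |M.limX ϑ t| ≤ L * (|M.y₀| * Real.exp (L * M.T)) * t := by
  have hL0 : 0 ≤ L := (abs_nonneg _).trans (hL 0 ⟨le_rfl, ht.1.trans ht.2⟩)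
  have h1 : ‖M.limX ϑ t‖ ≤ L * (|M.y₀| * Real.exp (L * M.T)) * |t - 0| := by
    refine intervalIntegral.norm_integral_le_of_norm_le_const fun r hr => ?_
    rw [Set.uIoc_of_le ht.1] at hr
    have hr' : r ∈ Set.Icc 0 M.T := ⟨hr.1.le, hr.2.trans ht.2⟩
    rw [norm_mul]
    exact mul_le_mul (hfL r hr') (abs_limY_le hL hr') (abs_nonneg _) hL0
  rwa [sub_zero, abs_of_nonneg ht.1] at h1

theorem continuousOn_limX {L t : ℝ} (hM : M.BoundedCoefficients) (hM' : M.SmoothDrift)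
    (hL : ∀ t ∈ Set.Icc 0 M.T,
      |M.f t| ≤ L ∧ |M.σ t| ≤ L ∧ |M.b t| ≤ L ∧ ∀ ϑ ∈ M.Θ, |M.a ϑ t| ≤ L)
    (ht : t ∈ Set.Icc 0 M.T) : ContinuousOn (fun ϑ => M.limX ϑ t) M.Θ := by
  have hL0 : 0 ≤ L := (abs_nonneg _).trans (hL t ht).1
  have hmem : ∀ s ∈ Set.Icc 0 M.T, ∀ r ∈ Set.uIoc 0 s, r ∈ Set.Icc 0 M.T := by
    intro s hs r hr
    rw [Set.uIoc_of_le hs.1] at hr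
    exact ⟨hr.1.le, hr.2.trans hs.2⟩
  have hY : ∀ s ∈ Set.Icc 0 M.T, ContinuousOn (fun ϑ => M.limY ϑ s) M.Θ := by
    intro s hs
    refine continuousOn_const.mul (ContinuousOn.rexp fun ϑ hϑ => ?_)
    refine intervalIntegral.continuousWithinAt_of_dominated_interval (bound := fun _ => L)
      ?_ ?_ (by simp) ?_
    · filter_upwards [self_mem_nhdsWithin] with θ hθ
      exact ((hM.aemeasurable_a θ hθ).mono_measure
        (Measure.restrict_mono (hmem s hs) le_rfl)).aestronglyMeasurable
    · filter_upwards [self_mem_nhdsWithin] with θ hθ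
      exact Eventually.of_forall fun r hr => (hL r (hmem s hs r hr)).2.2.2 θ hθ
    · exact Eventually.of_forall fun r hr =>
        (hM'.contDiff_ϑ r (hmem s hs r hr)).continuousOn ϑ hϑ
  intro ϑ hϑ
  refine intervalIntegral.continuousWithinAt_of_dominated_interval
    (bound := fun _ => L * (|M.y₀| * Real.exp (L * M.T))) ?_ ?_ (by simp) ?_
  · filter_upwards [self_mem_nhdsWithin] with θ hθ
    have h1 : AEMeasurable (fun s => M.f s * M.limY θ s) (volume.restrict (Set.Icc 0 M.T)) :=
      hM.aemeasurable_f.mul ((continuousOn_limY hL0 (hM.aemeasurable_a θ hθ)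
        (fun r hr => (hL r hr).2.2.2 θ hθ)).aemeasurable measurableSet_Icc)
    exact (h1.mono_measure (Measure.restrict_mono (hmem t ht) le_rfl)).aestronglyMeasurable
  · filter_upwards [self_mem_nhdsWithin] with θ hθ
    refine Eventually.of_forall fun r hr => ?_
    have hr' := hmem t ht r hr
    rw [norm_mul]
    exact mul_le_mul (hL r hr').1 (abs_limY_le (fun r hr => (hL r hr).2.2.2 θ hθ) hr')
      (abs_nonneg _) hL0
  · exact Eventually.of_forall fun r hr =>
      continuousWithinAt_const.mul (hY r (hmem t ht r hr) ϑ hϑ)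

/-- Quadratic separation of the noiseless observations at small times. -/
theorem exists_mul_sub_le_limX_sub {L : ℝ} (hT : 0 < M.T) (hM : M.BoundedCoefficients)
    (hM' : M.SmoothDrift) (hM'' : M.SeparatedFromZero) (hy₀ : M.y₀ ≠ 0)
    (hf : ContinuousWithinAt M.f (Set.Icc 0 M.T) 0) (hf₀ : M.f 0 ≠ 0)
    (hL : ∀ t ∈ Set.Icc 0 M.T,
      |M.f t| ≤ L ∧ |M.σ t| ≤ L ∧ |M.b t| ≤ L ∧ ∀ ϑ ∈ M.Θ, |M.a ϑ t| ≤ L) :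
    ∃ c > 0, ∃ t₀ > 0, ∀ t ∈ Set.Ioo 0 t₀, t ≤ M.T → ∀ ϑ₁ ∈ M.Θ, ∀ ϑ₂ ∈ M.Θ, ϑ₁ ≤ ϑ₂ →
      c * t ^ 2 * (ϑ₂ - ϑ₁) ≤ M.y₀ * M.f 0 * (M.limX ϑ₂ t - M.limX ϑ₁ t) := by
  have hL0 : 0 ≤ L := (abs_nonneg _).trans (hL 0 ⟨le_rfl, hT.le⟩).1
  obtain ⟨c, hc, t₁, ht₁, hdrift⟩ := exists_mul_sub_le_drift_sub hM' hM''
  -- Multiplication by `κ` makes the noiseless observation increasing in `ϑ` whatever the signs of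
  -- `y₀` and `f 0`: near time `0`, `κ y₀ f s` is close to `κ² > 0`.
  set κ := M.y₀ * M.f 0 with hκ
  have hκ0 : κ ≠ 0 := mul_ne_zero hy₀ hf₀
  have hκ2 : 0 < κ ^ 2 := by positivity
  have hev : ∀ᶠ s in 𝓝[Set.Icc 0 M.T] 0, κ ^ 2 / 2 < κ * (M.y₀ * M.f s) := by
    have h1 : ContinuousWithinAt (fun s => κ * (M.y₀ * M.f s)) (Set.Icc 0 M.T) 0 :=
      continuousWithinAt_const.mul (continuousWithinAt_const.mul hf)
    refine h1.eventually (lt_mem_nhds ?_)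
    change κ ^ 2 / 2 < κ * κ
    nlinarith
  obtain ⟨t₂, ht₂, hev⟩ := Metric.mem_nhdsWithin_iff.1 hev
  refine ⟨κ ^ 2 * Real.exp (-(L * M.T)) * c / 4, by positivity, min t₁ t₂, lt_min ht₁ ht₂,
    fun t ht htT ϑ₁ h₁ ϑ₂ h₂ h₁₂ => ?_⟩
  have htm : t ∈ Set.Icc 0 M.T := ⟨ht.1.le, htT⟩
  have ha := fun ϑ hϑ r hr => (hL r hr).2.2.2 ϑ hϑ
  have hi : ∀ ϑ ∈ M.Θ, IntervalIntegrable (fun s => M.f s * M.limY ϑ s) volume 0 t := fun ϑ hϑ =>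
    intervalIntegrable_mul_continuousOn hL0 hM.aemeasurable_f (fun r hr => (hL r hr).1)
      (continuousOn_limY hL0 (hM.aemeasurable_a ϑ hϑ) (ha ϑ hϑ)) htm
  have hΔ : 0 ≤ ϑ₂ - ϑ₁ := sub_nonneg.2 h₁₂
  -- The integrand gains a factor `s` from `exp (A₂ - A₁) - 1 ≥ A₂ - A₁`; integrating it produces
  -- `t² / 2`, hence the `4` in the constant.
  have hpt : ∀ s ∈ Set.Icc 0 t, κ ^ 2 / 2 * Real.exp (-(L * M.T)) * (c * (ϑ₂ - ϑ₁)) * s ≤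
      κ * (M.f s * M.limY ϑ₂ s - M.f s * M.limY ϑ₁ s) := by
    intro s hs
    have hsm : s ∈ Set.Icc 0 M.T := ⟨hs.1, hs.2.trans htT⟩
    have hfs : κ ^ 2 / 2 ≤ κ * (M.y₀ * M.f s) := by
      refine le_of_lt (hev ⟨?_, hsm⟩)
      rw [Metric.mem_ball, Real.dist_eq, sub_zero, abs_of_nonneg hs.1]
      exact hs.2.trans_lt (ht.2.trans_le (min_le_right _ _))
    have h0m : (0 : ℝ) ∈ Set.Icc 0 M.T := ⟨le_rfl, hT.le⟩
    have hi₁ := intervalIntegrable_of_bounded (hM.aemeasurable_a ϑ₁ h₁) (ha ϑ₁ h₁) h0m hsm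
    have hi₂ := intervalIntegrable_of_bounded (hM.aemeasurable_a ϑ₂ h₂) (ha ϑ₂ h₂) h0m hsm
    set A₁ := ∫ r in (0 : ℝ)..s, M.a ϑ₁ r with hA₁
    set A₂ := ∫ r in (0 : ℝ)..s, M.a ϑ₂ r with hA₂
    have hA : c * (ϑ₂ - ϑ₁) * s ≤ A₂ - A₁ := by
      rw [hA₁, hA₂, ← intervalIntegral.integral_sub hi₂ hi₁]
      calc c * (ϑ₂ - ϑ₁) * s = ∫ r in (0 : ℝ)..s, c * (ϑ₂ - ϑ₁) := by simp; ring
        _ ≤ _ := by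
          refine intervalIntegral.integral_mono_on_of_le_Ioo hs.1 (by simp) (hi₂.sub hi₁)
            fun r hr => ?_
          exact hdrift r ⟨hr.1, (hr.2.trans_le hs.2).trans (ht.2.trans_le (min_le_left _ _))⟩
            (hr.2.le.trans hsm.2) ϑ₁ h₁ ϑ₂ h₂ h₁₂
    have hE : Real.exp (-(L * M.T)) ≤ Real.exp A₁ :=
      Real.exp_le_exp.2 (abs_le.1 (abs_integral_drift_le (ha ϑ₁ h₁) hsm)).1
    have hD : c * (ϑ₂ - ϑ₁) * s ≤ Real.exp (A₂ - A₁) - 1 := by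
      linarith [Real.add_one_le_exp (A₂ - A₁)]
    have hcs : 0 ≤ c * (ϑ₂ - ϑ₁) * s := mul_nonneg (mul_nonneg hc.le hΔ) hs.1
    have hsplit : κ * (M.f s * M.limY ϑ₂ s - M.f s * M.limY ϑ₁ s) =
        κ * (M.y₀ * M.f s) * Real.exp A₁ * (Real.exp (A₂ - A₁) - 1) := by
      have : Real.exp A₂ = Real.exp A₁ * Real.exp (A₂ - A₁) := by rw [← Real.exp_add]; ring_nf
      simp only [limY, ← hA₁, ← hA₂]
      rw [this]; ring
    have hfs0 : 0 ≤ κ * (M.y₀ * M.f s) := by linarith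
    rw [hsplit, mul_assoc (κ ^ 2 / 2 * _)]
    gcongr
  have h := intervalIntegral.integral_mono_on
    (f := fun s => κ ^ 2 / 2 * Real.exp (-(L * M.T)) * (c * (ϑ₂ - ϑ₁)) * s) ht.1.le
    ((continuous_const.mul continuous_id).intervalIntegrable 0 t)
    (((hi ϑ₂ h₂).sub (hi ϑ₁ h₁)).const_mul κ) hpt
  rw [intervalIntegral.integral_const_mul, intervalIntegral.integral_const_mul,
    intervalIntegral.integral_sub (hi ϑ₂ h₂) (hi ϑ₁ h₁), integral_id] at h
  refine le_trans (le_of_eq ?_) h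
  ring

end HiddenModel

/-! ### Inversion: from the observation to the estimator. -/

namespace HiddenModel

variable {M : HiddenModel}

theorem prelim_mem_and_limX_prelim {τ x : ℝ} (hΘ : M.Θ.Nonempty)
    (hcont : ContinuousOn (fun ϑ => M.limX ϑ τ) M.Θ)
    (hx : x ∈ Set.Ioo (M.xInf τ) (M.xSup τ)) :
    M.prelim τ x ∈ M.Θ ∧ M.limX (M.prelim τ x) τ = x := by
  have hne := hΘ.image fun ϑ => M.limX ϑ τ
  obtain ⟨_, ⟨ϑ₁, h₁, rfl⟩, hlt₁⟩ := exists_lt_of_csInf_lt hne hx.1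
  obtain ⟨_, ⟨ϑ₂, h₂, rfl⟩, hlt₂⟩ := exists_lt_of_lt_csSup hne hx.2
  have hex : ∃ ϑ ∈ M.Θ, M.limX ϑ τ = x :=
    isPreconnected_Ioo.intermediate_value h₁ h₂ hcont ⟨hlt₁.le, hlt₂.le⟩
  rw [prelim, if_neg (not_le.2 hx.1), if_neg (not_le.2 hx.2)]
  exact ⟨Function.invFunOn_mem hex, Function.invFunOn_eq hex⟩

theorem mul_abs_sub_le_of_separated {τ k κ ϑ₁ ϑ₂ : ℝ}
    (hsep : ∀ ϑ₁ ∈ M.Θ, ∀ ϑ₂ ∈ M.Θ, ϑ₁ ≤ ϑ₂ →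
      k * (ϑ₂ - ϑ₁) ≤ κ * (M.limX ϑ₂ τ - M.limX ϑ₁ τ)) (h₁ : ϑ₁ ∈ M.Θ) (h₂ : ϑ₂ ∈ M.Θ) :
    k * |ϑ₂ - ϑ₁| ≤ |κ| * |M.limX ϑ₂ τ - M.limX ϑ₁ τ| := by
  wlog h : ϑ₁ ≤ ϑ₂ generalizing ϑ₁ ϑ₂
  · rw [abs_sub_comm, abs_sub_comm (M.limX ϑ₂ τ)]
    exact this h₂ h₁ (le_of_not_ge h)
  rw [abs_of_nonneg (sub_nonneg.2 h), ← abs_mul]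
  exact (hsep ϑ₁ h₁ ϑ₂ h₂ h).trans (le_abs_self _)

/-- Separation makes the inverse Lipschitz with constant `|κ| / k` between `xInf` and `xSup`;
outside, the estimator is a two-valued threshold function. -/
theorem measurable_prelim {τ k κ : ℝ} (hΘ : M.Θ.Nonempty) (hk : 0 < k)
    (hcont : ContinuousOn (fun ϑ => M.limX ϑ τ) M.Θ)
    (hsep : ∀ ϑ₁ ∈ M.Θ, ∀ ϑ₂ ∈ M.Θ, ϑ₁ ≤ ϑ₂ →
      k * (ϑ₂ - ϑ₁) ≤ κ * (M.limX ϑ₂ τ - M.limX ϑ₁ τ)) : Measurable (M.prelim τ) := by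
  refine measurable_of_restrict_of_restrict_compl
    (measurableSet_Ioo (a := M.xInf τ) (b := M.xSup τ)) ?_ ?_
  · have hlip : LipschitzOnWith (|κ| / k).toNNReal (M.prelim τ)
        (Set.Ioo (M.xInf τ) (M.xSup τ)) := by
      refine LipschitzOnWith.of_dist_le_mul fun x hx y hy => ?_
      obtain ⟨hxm, hxe⟩ := prelim_mem_and_limX_prelim hΘ hcont hx
      obtain ⟨hym, hye⟩ := prelim_mem_and_limX_prelim hΘ hcont hy
      have h := mul_abs_sub_le_of_separated hsep hym hxm
      rw [hxe, hye] at h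
      rw [Real.dist_eq, Real.dist_eq, Real.coe_toNNReal _ (by positivity), div_mul_eq_mul_div,
        le_div_iff₀ hk, mul_comm]
      exact h
    exact hlip.continuousOn.domRestrict.measurable
  · have : (Set.Ioo (M.xInf τ) (M.xSup τ))ᶜ.domRestrict (M.prelim τ) =
        fun x : ↥(Set.Ioo (M.xInf τ) (M.xSup τ))ᶜ => if (x : ℝ) ≤ M.xInf τ then M.α else M.β := by
      ext ⟨x, hx⟩
      simp only [Set.domRestrict_apply, prelim]
      by_cases h : x ≤ M.xInf τ
      · simp [h]
      · have : M.xSup τ ≤ x := by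
          by_contra h'
          exact hx ⟨not_le.1 h, not_le.1 h'⟩
        simp [h, this]
    rw [this]
    exact Measurable.ite (measurableSet_le measurable_subtype_coe measurable_const)
      measurable_const measurable_const

/-- The error of the preliminary estimator is controlled by the deviation of the observation from
its noiseless limit, uniformly over parameters at distance at least `d` from the boundary. -/
theorem abs_prelim_sub_le {τ k κ d ϑ₀ : ℝ} (x : ℝ) (hk : 0 < k) (hd : 0 < d)
    (hcont : ContinuousOn (fun ϑ => M.limX ϑ τ) M.Θ)
    (hbdd : BddBelow ((fun ϑ => M.limX ϑ τ) '' M.Θ)) (hbdd' : BddAbove ((fun ϑ => M.limX ϑ τ) '' M.Θ))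
    (hsep : ∀ ϑ₁ ∈ M.Θ, ∀ ϑ₂ ∈ M.Θ, ϑ₁ ≤ ϑ₂ →
      k * (ϑ₂ - ϑ₁) ≤ κ * (M.limX ϑ₂ τ - M.limX ϑ₁ τ))
    (h₀ : ϑ₀ ∈ M.Θ) (hl : ϑ₀ - d ∈ M.Θ) (hr : ϑ₀ + d ∈ M.Θ) :
    |M.prelim τ x - ϑ₀| ≤
      (1 + (M.β - M.α) / d) * |κ| / k * |x - M.limX ϑ₀ τ| := by
  have hαβ : 0 < M.β - M.α := by linarith [h₀.1, h₀.2]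
  have hsepl := hsep _ hl _ h₀ (by linarith)
  have hsepr := hsep _ h₀ _ hr (by linarith)
  -- For the boundary values: the error is at most `β - α`, while a deviation of at least `k d /
  -- |κ|` pays for an error `d`; this accounts for the factor `(β - α) / d`.
  have hfar : ∀ θ, |θ - ϑ₀| ≤ M.β - M.α → k * d ≤ |κ| * |x - M.limX ϑ₀ τ| →
      |θ - ϑ₀| ≤ (1 + (M.β - M.α) / d) * |κ| / k * |x - M.limX ϑ₀ τ| := by
    intro θ h1 h2
    calc |θ - ϑ₀| ≤ (M.β - M.α) / d * d := by rwa [div_mul_cancel₀ _ hd.ne']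
      _ ≤ (1 + (M.β - M.α) / d) * d := by gcongr; linarith
      _ = (1 + (M.β - M.α) / d) / k * (k * d) := by field_simp
      _ ≤ (1 + (M.β - M.α) / d) / k * (|κ| * |x - M.limX ϑ₀ τ|) := by gcongr
      _ = _ := by ring
  -- The sign of `κ` decides which of `ϑ₀ - d` and `ϑ₀ + d` lowers the noiseless observation.
  have hlow : ∃ ϑ ∈ M.Θ, k * d ≤ |κ| * (M.limX ϑ₀ τ - M.limX ϑ τ) := by
    rcases abs_cases κ with ⟨e, _⟩ | ⟨e, _⟩ <;> rw [e]
    · exact ⟨_, hl, by linarith⟩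
    · exact ⟨_, hr, by linarith⟩
  have hup : ∃ ϑ ∈ M.Θ, k * d ≤ |κ| * (M.limX ϑ τ - M.limX ϑ₀ τ) := by
    rcases abs_cases κ with ⟨e, _⟩ | ⟨e, _⟩ <;> rw [e]
    · exact ⟨_, hr, by linarith⟩
    · exact ⟨_, hl, by linarith⟩
  by_cases h1 : x ≤ M.xInf τ
  · obtain ⟨ϑ, hϑ, hd'⟩ := hlow
    have hx : x ≤ M.limX ϑ τ := h1.trans (csInf_le hbdd ⟨ϑ, hϑ, rfl⟩)
    rw [prelim, if_pos h1]
    refine hfar _ (abs_le.2 ⟨by linarith [h₀.2], by linarith [h₀.1]⟩) (hd'.trans ?_)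
    refine mul_le_mul_of_nonneg_left ?_ (abs_nonneg _)
    rw [abs_sub_comm]
    exact (by linarith : _ ≤ M.limX ϑ₀ τ - x).trans (le_abs_self _)
  by_cases h2 : M.xSup τ ≤ x
  · obtain ⟨ϑ, hϑ, hd'⟩ := hup
    have hx : M.limX ϑ τ ≤ x := (le_csSup hbdd' ⟨ϑ, hϑ, rfl⟩).trans h2
    rw [prelim, if_neg h1, if_pos h2]
    refine hfar _ (abs_le.2 ⟨by linarith [h₀.2], by linarith [h₀.1]⟩) (hd'.trans ?_)
    refine mul_le_mul_of_nonneg_left ?_ (abs_nonneg _)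
    exact (by linarith : _ ≤ x - M.limX ϑ₀ τ).trans (le_abs_self _)
  obtain ⟨hm, he⟩ := prelim_mem_and_limX_prelim ⟨ϑ₀, h₀⟩ hcont ⟨not_le.1 h1, not_le.1 h2⟩
  have h := mul_abs_sub_le_of_separated hsep h₀ hm
  rw [he] at h
  calc |M.prelim τ x - ϑ₀| = (1 / k) * (k * |M.prelim τ x - ϑ₀|) := by field_simp
    _ ≤ (1 / k) * (|κ| * |x - M.limX ϑ₀ τ|) := by gcongr
    _ = 1 * |κ| / k * |x - M.limX ϑ₀ τ| := by ring
    _ ≤ _ := by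
      have : 0 ≤ (M.β - M.α) / d := by positivity
      gcongr
      linarith

/-- The mean square error of the preliminary estimator for given observation time and noise
level. -/
theorem exists_lintegral_sq_prelim_sub_le {K : Set ℝ} (hT : 0 < M.T) (hM : M.BoundedCoefficients)
    (hM' : M.SmoothDrift) (hM'' : M.SeparatedFromZero) (hy₀ : M.y₀ ≠ 0)
    (hf : ContinuousWithinAt M.f (Set.Icc 0 M.T) 0) (hf₀ : M.f 0 ≠ 0)
    (hK : IsCompact K) (hKΘ : K ⊆ M.Θ) :
    ∃ C > 0, ∃ τ₀ > 0, τ₀ ≤ M.T ∧ ∀ τ ∈ Set.Ioo 0 τ₀, ∀ ε > 0, ∀ ϑ₀ ∈ K,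
      ∀ (Ω : Type*) [MeasurableSpace Ω] (P : Measure Ω) (W V : ℝ≥0 → Ω → ℝ) (X Y : ℝ → Ω → ℝ),
        M.IsSystem ϑ₀ ε P W V X Y →
          Measurable (M.prelim τ) ∧
          ∫⁻ ω, ENNReal.ofReal (|M.prelim τ (X τ ω) - ϑ₀| ^ 2) ∂P ≤
            ENNReal.ofReal (C * (ε ^ 2 / τ ^ 3)) := by
  obtain ⟨L, hL⟩ := hM.bounded
  have hL0 : 0 ≤ L := (abs_nonneg _).trans (hL 0 ⟨le_rfl, hT.le⟩).1
  obtain ⟨c, hc, t₀, ht₀, hsep⟩ := exists_mul_sub_le_limX_sub hT hM hM' hM'' hy₀ hf hf₀ hL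
  -- Compactness supplies one margin `d` for all `ϑ₀ ∈ K`, which makes the constant uniform.
  obtain ⟨d, hd, hdΘ⟩ := hK.exists_cthickening_subset_open isOpen_Ioo hKΘ
  set κ := M.y₀ * M.f 0
  set D := (1 + (M.β - M.α) / d) * |κ| / c with hD
  -- The `+ 1` ensures `C > 0`; the bound `1 / (2 (L + 1))` gives `L τ ≤ 1/2` even if `L = 0`.
  refine ⟨4 * L ^ 2 * D ^ 2 + 1, by positivity, min M.T (min t₀ (1 / (2 * (L + 1)))),
    lt_min hT (lt_min ht₀ (by positivity)), min_le_left _ _, ?_⟩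
  intro τ hτ ε hε ϑ₀ hϑ₀ Ω _ P W V X Y hsys
  have hτ0 : 0 < τ := hτ.1
  have hτT : τ ≤ M.T := hτ.2.le.trans (min_le_left _ _)
  have hτt : τ < t₀ := hτ.2.trans_le ((min_le_right _ _).trans (min_le_left _ _))
  have hτL : τ < 1 / (2 * (L + 1)) := hτ.2.trans_le ((min_le_right _ _).trans (min_le_right _ _))
  have hLτ : L * τ ≤ 1 / 2 := by
    rw [lt_div_iff₀ (by positivity)] at hτL
    nlinarith
  have hτm : τ ∈ Set.Icc 0 M.T := ⟨hτ0.le, hτT⟩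
  have hΘ₀ : ϑ₀ ∈ M.Θ := hKΘ hϑ₀
  have hsepτ := hsep τ ⟨hτ0, hτt⟩ hτT
  have hcont := continuousOn_limX hM hM' hL hτm
  have hk : 0 < c * τ ^ 2 := by positivity
  refine ⟨measurable_prelim ⟨ϑ₀, hΘ₀⟩ hk hcont hsepτ, ?_⟩
  have hb : ∀ y ∈ (fun ϑ => M.limX ϑ τ) '' M.Θ,
      |y| ≤ L * (|M.y₀| * Real.exp (L * M.T)) * τ := by
    rintro _ ⟨ϑ, hϑ, rfl⟩
    exact abs_limX_le (fun r hr => (hL r hr).1) (fun r hr => (hL r hr).2.2.2 ϑ hϑ) hτm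
  have hl : ϑ₀ - d ∈ M.Θ := hdΘ (Metric.mem_cthickening_of_dist_le _ ϑ₀ _ _ hϑ₀ (by
    simp [abs_of_pos hd]))
  have hr : ϑ₀ + d ∈ M.Θ := hdΘ (Metric.mem_cthickening_of_dist_le _ ϑ₀ _ _ hϑ₀ (by
    simp [abs_of_pos hd]))
  have hpt : ∀ x, |M.prelim τ x - ϑ₀| ^ 2 ≤ (D / τ ^ 2) ^ 2 * (x - M.limX ϑ₀ τ) ^ 2 := by
    intro x
    have h := abs_prelim_sub_le x hk hd hcont ⟨_, fun y hy => (abs_le.1 (hb y hy)).1⟩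
      ⟨_, fun y hy => (abs_le.1 (hb y hy)).2⟩ hsepτ hΘ₀ hl hr
    rw [← sq_abs (x - M.limX ϑ₀ τ), ← mul_pow]
    refine pow_le_pow_left₀ (abs_nonneg _) (h.trans (le_of_eq ?_)) 2
    rw [hD, div_div]
  calc ∫⁻ ω, ENNReal.ofReal (|M.prelim τ (X τ ω) - ϑ₀| ^ 2) ∂P
      ≤ ∫⁻ ω, ENNReal.ofReal ((D / τ ^ 2) ^ 2) *
          ENNReal.ofReal ((X τ ω - M.limX ϑ₀ τ) ^ 2) ∂P := by
        refine lintegral_mono fun ω => ?_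
        rw [← ENNReal.ofReal_mul (sq_nonneg _)]
        exact ENNReal.ofReal_le_ofReal (hpt _)
    _ = ENNReal.ofReal ((D / τ ^ 2) ^ 2) *
          ∫⁻ ω, ENNReal.ofReal ((X τ ω - M.limX ϑ₀ τ) ^ 2) ∂P :=
        lintegral_const_mul' _ _ ENNReal.ofReal_ne_top
    _ ≤ ENNReal.ofReal ((D / τ ^ 2) ^ 2) * ENNReal.ofReal (4 * L ^ 2 * ε ^ 2 * τ) := by
        gcongr
        exact hsys.lintegral_sq_sub_limX_le hM hΘ₀ hε hτ0 hτT hL0 hLτ hL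
    _ = ENNReal.ofReal ((D / τ ^ 2) ^ 2 * (4 * L ^ 2 * ε ^ 2 * τ)) :=
        (ENNReal.ofReal_mul (sq_nonneg _)).symm
    _ ≤ _ := by
        refine ENNReal.ofReal_le_ofReal ?_
        have h1 : (D / τ ^ 2) ^ 2 * (4 * L ^ 2 * ε ^ 2 * τ) =
            4 * L ^ 2 * D ^ 2 * (ε ^ 2 / τ ^ 3) := by field_simp
        rw [h1]
        have : 0 ≤ ε ^ 2 / τ ^ 3 := by positivity
        gcongr
        linarith

end HiddenModel

/-! ### The choice `τ = ε^δ` and the conclusion. -/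

theorem Real.exists_forall_rpow_lt {p r : ℝ} (hp : 0 < p) (hr : 0 < r) :
    ∃ ε₀ > 0, ∀ ε ∈ Set.Ioo (0 : ℝ) ε₀, ε ^ p < r := by
  refine ⟨r ^ p⁻¹, Real.rpow_pos_of_pos hr _, fun ε hε => ?_⟩
  exact (Real.lt_rpow_inv_iff_of_pos hε.1.le hr.le hp).1 hε.2

theorem HiddenModel.exists_lintegral_sq_prelim_rpow_sub_le {M : HiddenModel} {K : Set ℝ} {δ : ℝ}
    (hT : 0 < M.T) (hM : M.BoundedCoefficients)
    (hM' : M.SmoothDrift) (hM'' : M.SeparatedFromZero) (hy₀ : M.y₀ ≠ 0)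
    (hf : ContinuousWithinAt M.f (Set.Icc 0 M.T) 0) (hf₀ : M.f 0 ≠ 0) (hδ : 0 < δ)
    (hK : IsCompact K) (hKΘ : K ⊆ M.Θ) :
    ∃ C > 0, ∃ ε₀ > 0, ∀ ε ∈ Set.Ioo (0 : ℝ) ε₀, ∀ ϑ₀ ∈ K,
      ∀ (Ω : Type*) [MeasurableSpace Ω] (P : Measure Ω) (W V : ℝ≥0 → Ω → ℝ) (X Y : ℝ → Ω → ℝ),
        M.IsSystem ϑ₀ ε P W V X Y →
          AEMeasurable (fun ω => M.prelim (ε ^ δ) (X (ε ^ δ) ω)) P ∧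
          ∫⁻ ω, ENNReal.ofReal (|M.prelim (ε ^ δ) (X (ε ^ δ) ω) - ϑ₀| ^ 2) ∂P ≤
            ENNReal.ofReal (C * ε ^ (2 - 3 * δ)) := by
  obtain ⟨C, hC, τ₀, hτ₀, hτT, h⟩ :=
    exists_lintegral_sq_prelim_sub_le hT hM hM' hM'' hy₀ hf hf₀ hK hKΘ
  obtain ⟨ε₀, hε₀, hε⟩ := Real.exists_forall_rpow_lt hδ hτ₀
  refine ⟨C, hC, ε₀, hε₀, fun ε hεm ϑ₀ hϑ₀ Ω _ P W V X Y hsys => ?_⟩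
  have hτ : ε ^ δ ∈ Set.Ioo 0 τ₀ := ⟨Real.rpow_pos_of_pos hεm.1 δ, hε ε hεm⟩
  obtain ⟨hm, hle⟩ := h _ hτ ε hεm.1 ϑ₀ hϑ₀ Ω P W V X Y hsys
  refine ⟨hm.comp_aemeasurable (hsys.aemeasurable_X _ ⟨hτ.1.le, hτ.2.le.trans hτT⟩), ?_⟩
  have e : ε ^ 2 / (ε ^ δ) ^ 3 = ε ^ (2 - 3 * δ) := by
    rw [Real.rpow_sub hεm.1, mul_comm 3 δ, Real.rpow_mul hεm.1.le, Real.rpow_ofNat,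
      Real.rpow_ofNat]
  rwa [e] at hle

theorem proposition1 (M : HiddenModel) (hT : 0 < M.T) (hΘ : M.α < M.β)
    (hR1 : M.BoundedCoefficients)
    (hR2 : M.SmoothDrift)
    (hR3 : M.SeparatedFromZero)
    (hR4 : M.y₀ ≠ 0)
    (hf_cont : ContinuousWithinAt M.f (Set.Icc 0 M.T) 0) (hf_zero : M.f 0 ≠ 0)
    (δ : ℝ) (hδ : δ ∈ Set.Ioo (0 : ℝ) (2 / 3))
    (K : Set ℝ) (hK : IsCompact K) (hKΘ : K ⊆ M.Θ) :
    (∀ ν > 0, ∀ η > 0, ∃ ε₀ > 0, ∀ ε ∈ Set.Ioo (0 : ℝ) ε₀, ∀ ϑ₀ ∈ K,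
      ∀ (Ω : Type*) [MeasurableSpace Ω] (P : Measure Ω) (W V : ℝ≥0 → Ω → ℝ) (X Y : ℝ → Ω → ℝ),
        M.IsSystem ϑ₀ ε P W V X Y →
          P {ω | ν < |M.prelim (ε ^ δ) (X (ε ^ δ) ω) - ϑ₀|} ≤ ENNReal.ofReal η) ∧
    (∃ C > 0, ∃ ε₀ > 0, ∀ ε ∈ Set.Ioo (0 : ℝ) ε₀, ∀ ϑ₀ ∈ K,
      ∀ (Ω : Type*) [MeasurableSpace Ω] (P : Measure Ω) (W V : ℝ≥0 → Ω → ℝ) (X Y : ℝ → Ω → ℝ),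
        M.IsSystem ϑ₀ ε P W V X Y →
          AEMeasurable (fun ω => M.prelim (ε ^ δ) (X (ε ^ δ) ω)) P ∧
          Integrable (fun ω => |M.prelim (ε ^ δ) (X (ε ^ δ) ω) - ϑ₀| ^ 2) P ∧
          ∫ ω, |M.prelim (ε ^ δ) (X (ε ^ δ) ω) - ϑ₀| ^ 2 ∂P ≤ C * ε ^ (2 - 3 * δ)) := by
  refine ⟨fun ν hν η hη => ?_, ?_⟩
  · obtain ⟨C, hC, ε₀, hε₀, h⟩ := HiddenModel.exists_lintegral_sq_prelim_rpow_sub_le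
      hT hR1 hR2 hR3 hR4 hf_cont hf_zero hδ.1 hK hKΘ
    -- Here `δ < 2/3` makes the exponent positive. The threshold is chosen so that the mean square
    -- error is at most `ν² η`, as Chebyshev's inequality requires.
    obtain ⟨ε₁, hε₁, hr⟩ := Real.exists_forall_rpow_lt (p := 2 - 3 * δ) (r := ν ^ 2 * η / C)
      (by linarith [hδ.2]) (by positivity)
    refine ⟨min ε₀ ε₁, lt_min hε₀ hε₁, fun ε hε ϑ₀ hϑ₀ Ω _ P W V X Y hsys => ?_⟩
    obtain ⟨hm, hle⟩ := h ε ⟨hε.1, hε.2.trans_le (min_le_left _ _)⟩ ϑ₀ hϑ₀ Ω P W V X Y hsys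
    have hrε := hr ε ⟨hε.1, hε.2.trans_le (min_le_right _ _)⟩
    rw [lt_div_iff₀ hC, mul_comm] at hrε
    have hm2 : AEMeasurable (fun ω =>
        ENNReal.ofReal (|M.prelim (ε ^ δ) (X (ε ^ δ) ω) - ϑ₀| ^ 2)) P :=
      ((hm.sub_const ϑ₀).abs.pow_const 2).ennreal_ofReal
    have hmarkov := mul_meas_ge_le_lintegral₀ hm2 (ENNReal.ofReal (ν ^ 2))
    have hν2 : 0 < ν ^ 2 := by positivity
    rw [← ENNReal.mul_le_mul_iff_right (a := ENNReal.ofReal (ν ^ 2)) (by simpa using hν.ne')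
      ENNReal.ofReal_ne_top, ← ENNReal.ofReal_mul hν2.le]
    refine le_trans ?_ ((hmarkov.trans hle).trans (ENNReal.ofReal_le_ofReal hrε.le))
    refine mul_le_mul_right (measure_mono fun ω hω => ?_) _
    exact ENNReal.ofReal_le_ofReal (pow_le_pow_left₀ hν.le (le_of_lt hω) 2)
  · obtain ⟨C, hC, ε₀, hε₀, h⟩ := HiddenModel.exists_lintegral_sq_prelim_rpow_sub_le
      hT hR1 hR2 hR3 hR4 hf_cont hf_zero hδ.1 hK hKΘ
    refine ⟨C, hC, ε₀, hε₀, fun ε hε ϑ₀ hϑ₀ Ω _ P W V X Y hsys => ?_⟩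
    obtain ⟨hm, hle⟩ := h ε hε ϑ₀ hϑ₀ Ω P W V X Y hsys
    have hnn : 0 ≤ᵐ[P] fun ω => |M.prelim (ε ^ δ) (X (ε ^ δ) ω) - ϑ₀| ^ 2 :=
      Eventually.of_forall fun ω => sq_nonneg _
    have hint : Integrable (fun ω => |M.prelim (ε ^ δ) (X (ε ^ δ) ω) - ϑ₀| ^ 2) P := by
      refine ⟨((hm.sub_const ϑ₀).abs.pow_const 2).aestronglyMeasurable, ?_⟩
      rw [hasFiniteIntegral_iff_ofReal hnn]
      exact hle.trans_lt ENNReal.ofReal_lt_top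
    refine ⟨hm, hint, ?_⟩
    rw [← ofReal_integral_eq_lintegral_ofReal hint hnn] at hle
    exact (ENNReal.ofReal_le_ofReal_iff
      (mul_nonneg hC.le (Real.rpow_nonneg hε.1.le _))).1 hle
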